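/- Let $W$ be a finite classical formed space on a finite-dimensional vector space $V$ over a finite field: $V$ carries a non-degenerate alternating form, a non-degenerate Hermitian form, or a non-degenerate quadratic form (so $W$ is one of $Sp(2n,q)$, $U(n,\sqrt q)$, $\Omega(2n+1,q)$, $\Omega^{\pm}(2n,q)$). Let $B$ be the form (in the quadratic case, the polar form of the quadratic form). Call a subspace singular if $B$ vanishes on it identically (in the quadratic case: if the quadratic form vanishes on it), and let $\omega$ be the Witt index, i.e. the largest dimension of a singular subspace. For $1\le k<\omega$ let $\Gamma=PG_W(k)$ be the polar Grassmann graph: its vertices are the singular $k$-subspaces, and $X,Y$ are adjacent when $X+Y$ is a singular subspace of dimension $k+1$. A geodesic of length $m$ is a sequence $(X_0,\dots,X_m)$ of vertices, consecutive ones adjacent, such that $X_0$ and $X_m$ are at distance $m$. Two distinct vertices $X,Y$ are opposite if for every $y\in Y\setminus X$ there is $x\in X\setminus Y$ with $B(x,y)\ne 0$. Let $1\le m\le k$. Call a sequence of integers $t=(t_1,\dots,t_m)$ an admissible type if $t_1=1$, $t_i\in\{t_{i-1},\,t_{i-1}+1\}$ for $2\le i\le m$, and $t_i\le \omega-k$ for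 all $i$, and put $c_t=\bigl(\prod_{i=1}^m t_i\bigr)/(t_m!)$. Then the geodesics of length $m$ in $\Gamma$ with non-opposite ends fall into exactly $$\mathcal L(m)=\sum_{t\ \text{admissible}} c_t$$ orbits of the full automorphism group $\operatorname{Aut}\Gamma$; that is, exactly $\mathcal L(m)$ orbits of $\operatorname{Aut}\Gamma$ on the geodesics of length $m$ contain a geodesic with non-opposite ends. If moreover $m\le\omega-k$, then $\mathcal L(m)$ equals the Bell number $B(m)$, the number of partitions of an $m$-element set. -/

import Mathlib

open Module

/-- A non-degenerate formed space (classical polar space) on a vector space `V` over `K`.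
Over a finite field, and with `V` finite-dimensional, the three cases give exactly the spaces
`Sp(2n, q)`; `Ω(2n+1, q)`, `Ω⁺(2n, q)`, `Ω⁻(2n+2, q)`; `U(2n, √q)`, `U(2n+1, √q)`.
The orthogonal spaces are given by a quadratic form, so that characteristic two is covered. -/
inductive FormedSpace (K V : Type*) [Field K] [AddCommGroup V] [Module K V] where
  | symplectic (B : LinearMap.BilinForm K V) (alt : B.IsAlt) (nondeg : B.Nondegenerate)
  | orthogonal (Q : QuadraticForm K V) (nondeg : Q.Nondegenerate)
  | unitary (σ : K →+* K) (invol : ∀ a, σ (σ a) = a) (nontriv : ∃ a, σ a ≠ a)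
      (B : V →ₛₗ[σ] V →ₗ[K] K) (herm : B.IsSymm) (nondeg : B.Nondegenerate)

namespace FormedSpace

variable {K V : Type*} [Field K] [AddCommGroup V] [Module K V]

/-- The reflexive form `B` of the space (the polar form, for an orthogonal space). -/
def form : FormedSpace K V → V → V → K
  | symplectic B _ _, u, v => B u v
  | orthogonal Q _, u, v => QuadraticMap.polar Q u v
  | unitary _ _ _ B _ _, u, v => B u v

/-- Singular subspaces: totally isotropic for `B` (that is, `U ≤ U^⊥`) in the symplectic and
unitary cases, and totally singular for `Q` in the orthogonal case (in odd characteristic this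
again means `U ≤ U^⊥`). -/
def IsSingular : FormedSpace K V → Submodule K V → Prop
  | symplectic B _ _, U => ∀ u ∈ U, ∀ v ∈ U, B u v = 0
  | orthogonal Q _, U => ∀ u ∈ U, Q u = 0
  | unitary _ _ _ B _ _, U => ∀ u ∈ U, ∀ v ∈ U, B u v = 0

/-- The Witt index `ω`: the largest dimension of a singular subspace. -/
noncomputable def wittIndex (W : FormedSpace K V) : ℕ :=
  sSup {d | ∃ U : Submodule K V, W.IsSingular U ∧ finrank K U = d}

/-- The singular `k`-subspaces of `W`. -/
abbrev SingularSubspace (W : FormedSpace K V) (k : ℕ) : Type _ :=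
  {U : Submodule K V // W.IsSingular U ∧ finrank K U = k}

/-- The polar Grassmann graph of `W` on the singular `k`-subspaces. For `k < ω` two of them are
adjacent when they span a singular `(k+1)`-subspace; for `k = ω` they are adjacent when they meet
in a `(k-1)`-subspace. -/
def polarGrassmannGraph (W : FormedSpace K V) (k : ℕ) :
    SimpleGraph (W.SingularSubspace k) where
  Adj X Y :=
    (k < W.wittIndex ∧ W.IsSingular (X.1 ⊔ Y.1) ∧
      finrank K (X.1 ⊔ Y.1 : Submodule K V) = k + 1) ∨
    (k = W.wittIndex ∧ finrank K (X.1 ⊓ Y.1 : Submodule K V) + 1 = k)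
  symm := ⟨fun X Y h => by rwa [sup_comm, inf_comm]⟩
  loopless := ⟨fun X h => by
    have hX := X.2.2
    rw [sup_idem, inf_idem, hX] at h
    omega⟩

/-- Opposite vertices: `X ≠ Y`, and every vector of `Y` outside `X` is non-orthogonal to some
vector of `X` outside `Y`. -/
def Opposite (W : FormedSpace K V) {k : ℕ} (X Y : W.SingularSubspace k) : Prop :=
  X ≠ Y ∧ ∀ y ∈ Y.1, y ∉ X.1 → ∃ x ∈ X.1, x ∉ Y.1 ∧ W.form x y ≠ 0

end FormedSpace

namespace SimpleGraph

variable {α : Type*}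

/-- A geodesic of length `m`, written as the sequence `(X 0, …, X m)` of its vertices: a walk
whose length `m` is the distance between its ends. -/
def IsGeodesicSeq (G : SimpleGraph α) {m : ℕ} (X : Fin (m + 1) → α) : Prop :=
  (∀ i : Fin m, G.Adj (X i.castSucc) (X i.succ)) ∧ G.dist (X 0) (X (Fin.last m)) = m

/-- The orbit of a sequence of vertices under the full automorphism group of `G`. -/
def autOrbit (G : SimpleGraph α) {m : ℕ} (X : Fin (m + 1) → α) : Set (Fin (m + 1) → α) :=
  {Y | ∃ φ : G ≃g G, ∀ i, Y i = φ (X i)}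

end SimpleGraph

namespace FormedSpace

variable {K V : Type*} [Field K] [AddCommGroup V] [Module K V]

/-- The geodesics of length `m` with non-opposite ends in the polar Grassmann graph. -/
def nonOppositeGeodesics (W : FormedSpace K V) (k m : ℕ) :
    Set (Fin (m + 1) → W.SingularSubspace k) :=
  {X | (W.polarGrassmannGraph k).IsGeodesicSeq X ∧ ¬ W.Opposite (X 0) (X (Fin.last m))}

/-- The orbits of the automorphism group of the polar Grassmann graph into which the geodesics of
length `m` with non-opposite ends fall. -/
def nonOppositeGeodesicOrbits (W : FormedSpace K V) (k m : ℕ) :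
    Set (Set (Fin (m + 1) → W.SingularSubspace k)) :=
  (W.polarGrassmannGraph k).autOrbit '' W.nonOppositeGeodesics k m

end FormedSpace

/-- Admissible types `t = (t₁, …, t_m)` with bound `s`: `t₁ = 1`, each further term is equal to
the previous one or larger by one, and no term exceeds `s`. (`t i` is the `(i+1)`-st term.) -/
def IsAdmissibleType {m : ℕ} (s : ℕ) (t : Fin m → ℕ) : Prop :=
  (∀ i : Fin m, i.val = 0 → t i = 1) ∧
  (∀ i j : Fin m, j.val = i.val + 1 → t j = t i ∨ t j = t i + 1) ∧
  ∀ i, t i ≤ s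

open Classical in
/-- The finite set of admissible types of length `m` with bound `s`. -/
noncomputable def admissibleTypes (m s : ℕ) : Finset (Fin m → ℕ) :=
  (Fintype.piFinset fun _ => Finset.range (s + 1)).filter (IsAdmissibleType s)

theorem mem_admissibleTypes {m s : ℕ} {t : Fin m → ℕ} :
    t ∈ admissibleTypes m s ↔ IsAdmissibleType s t := by
  simp only [admissibleTypes, Finset.mem_filter, Fintype.mem_piFinset, Finset.mem_range,
    and_iff_right_iff_imp]
  exact fun h i => Nat.lt_succ_of_le (h.2.2 i)

/-- The number `c_t = (t₁ ⋯ t_m) / (t_m)!` attached to a sequence `t` of length `m ≥ 1`. -/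
def typeCount {m : ℕ} (hm : 1 ≤ m) (t : Fin m → ℕ) : ℚ :=
  (∏ i, (t i : ℚ)) / (Nat.factorial (t ⟨m - 1, by omega⟩) : ℚ)

/-!
Everything is done with a common description `PolarData` of the three types of formed spaces: a
reflexive sesquilinear form `B` with a map `q` whose zeros are the singular vectors.

*Geodesics.* A walk of length `m` in the graph loses at most one dimension of intersection with its
first vertex per step, so vertices at finite distance `m` satisfy `dim (X ⊓ Y) ≥ k - m`. For
distinct non-opposite vertices equality holds (`FormedSpace.dist_of_close`): a vector of `X`
orthogonal to `Y` and outside `Y` can be kept until the last step. So the geodesics in question are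
the walks `X 0, …, X m` with `dim (X 0 ⊓ X m) = k - m`.

*Normal form.* Elimination along such a walk (`PolarData.IsPreNormal.exists_succ`) yields bases
`e i, …, e (k - 1), f 0, …, f (i - 1)` of the `X i`, independent altogether, on which the form is
the matrix of a partial matching between the `f j` and the `e l`, with `l < j` for matched pairs.
This matching is recorded as a code, the same thing as a partition of `m` points with `l` and `j`
consecutive elements of a block for each matched pair. The first vertex and the unmatched `f j` span
a singular subspace, so the number of blocks is at most `ω - k`; conversely, all these codes occur
inside a hyperbolic frame on a maximal singular subspace (`FormedSpace.exists_hasCode_of_code`).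
Ends of a walk in normal form are never opposite.

*Orbits.* Geodesics with equal codes are related by an isometry, because their bases extend to
hyperbolic frames and isometries act transitively on frames (`PolarData.IsFrame.exists_isometry`).
Conversely the dimensions of `X i ⊓ (X i')^⊥` determine the code (`PolarData.IsNormal.code_eq`), and
they are invariants of the graph without any appeal to the structure of its automorphism group: for
close `X`, `Y` at distance at least two, the neighbours of `X` closer to `Y` embed into the pairs of
a hyperplane of `X` over `X ⊓ Y` and a point of `(Y ⊓ X^⊥) / (X ⊓ Y)`, and all pairs occur unless
that quotient has dimension one. So their number grows strictly with the dimension of `Y ⊓ X^⊥`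
(`FormedSpace.finrank_inf_perp_eq_of_iso`).

*Counting.* Adding one point to a partition with `z` blocks gives `z` partitions with `z` blocks and
one with `z + 1`. The weights `c_t`, summed over the types with last term `z`, and the Stirling
numbers of the second kind obey the same recursion.
-/

/-! ### Isometries of polar spaces -/

/-- What the symplectic, orthogonal and unitary geometries have in common: a reflexive sesquilinear
form `B`, which is `ε`-Hermitian for the involution `σ`, and a map `q` that cuts out the singular
vectors and whose polarization is `T ∘ B`.

In the symplectic case `σ = id`, `ε = -1` and `q = T = 0`; in the orthogonal case `σ = id`, `ε = 1`,
`q` is the quadratic form and `T = id`; in the unitary case `ε = 1`, `q x = B x x` and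
`T a = a + σ a`. By the law `T_surj` a vector becomes singular after adding a multiple of any
singular vector not orthogonal to it, and `nondeg` asks only that no nonzero singular vector lies in
the radical of `B`, so that quadratic forms in odd dimension and characteristic two are included. -/
structure PolarData (K V : Type*) [Field K] [AddCommGroup V] [Module K V] where
  σ : K →+* K
  ε : K
  B : V →ₛₗ[σ] V →ₗ[K] K
  q : V → K
  T : K →+ K
  σ_σ : ∀ a, σ (σ a) = a
  σ_ε : σ ε = ε
  ε_mul_ε : ε * ε = 1
  symm : ∀ x y, B y x = ε * σ (B x y)
  q_add : ∀ x y, q (x + y) = q x + q y + T (B x y)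
  q_smul : ∀ a x, q (a • x) = a * σ a * q x
  T_norm : ∀ a c, T (a * σ a * c) = a * σ a * T c
  T_ε : ∀ c, T (ε * c) = T c
  T_σ : ∀ c, T (σ c) = T c
  T_surj : ∀ x, ∃ a, T a = q x
  B_self : ∀ x, q x = 0 → B x x = 0
  nondeg : ∀ x, q x = 0 → (∀ y, B x y = 0) → x = 0

namespace PolarData

variable {K V : Type*} [Field K] [AddCommGroup V] [Module K V] (S : PolarData K V)

theorem ε_ne_zero : S.ε ≠ 0 := fun h => by simpa [h] using S.ε_mul_ε

theorem B_eq_zero_comm {x y : V} : S.B x y = 0 ↔ S.B y x = 0 := by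
  rw [S.symm x y]
  simp [S.ε_ne_zero]

theorem q_zero : S.q 0 = 0 := by simpa using S.q_smul 0 0

theorem q_neg (x : V) : S.q (-x) = S.q x := by simpa using S.q_smul (-1) x

/-- A linear map preserving the sesquilinear form and the quadratic map. -/
def IsIsometry (g : V →ₗ[K] V) : Prop :=
  (∀ x, S.q (g x) = S.q x) ∧ ∀ x y, S.B (g x) (g y) = S.B x y

variable {S}

theorem IsIsometry.comp {g h : V →ₗ[K] V} (hg : S.IsIsometry g) (hh : S.IsIsometry h) :
    S.IsIsometry (g ∘ₗ h) :=
  ⟨fun x => by simp [hg.1, hh.1], fun x y => by simp [hg.2, hh.2]⟩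

variable (S) in
theorem isIsometry_id : S.IsIsometry LinearMap.id := ⟨fun _ => rfl, fun _ _ => rfl⟩

theorem IsIsometry.injective {g : V →ₗ[K] V} (hg : S.IsIsometry g) : Function.Injective g := by
  rw [injective_iff_map_eq_zero]
  intro x hx
  refine S.nondeg x ?_ fun y => ?_
  · rw [← hg.1, hx, S.q_zero]
  · rw [← hg.2, hx]; simp

variable (S)

/-- Two non-orthogonal singular vectors are exchanged by an isometry that moves vectors only along
their difference: a reflection, a transvection or a quasi-reflection according to the type. -/
theorem exists_isometry_of_not_orthogonal {x y : V} (hx : S.q x = 0) (hy : S.q y = 0)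
    (h : S.B y x ≠ 0) :
    ∃ g, S.IsIsometry g ∧ g x = y ∧ ∀ v, S.B x v = S.B y v → g v = v := by
  set u := x - y with hu
  set l := (S.B y x)⁻¹ with hl
  -- the isometry is `v ↦ v + (B y x)⁻¹ B (x - y) v • (x - y)`
  have hxy : S.B x y = S.ε * S.σ (S.B y x) := S.symm y x
  have hσ : S.σ (S.B y x) ≠ 0 := by simpa using h
  have hll : l * S.σ l * S.B x y = S.ε * l := by
    rw [hxy, hl, map_inv₀]; field_simp
  have hqu : S.q u = - S.T (S.B x y) := by
    rw [hu, sub_eq_add_neg, S.q_add, hx, S.q_neg, hy]; simp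
  have hBu : S.B u u = - S.B x y - S.B y x := by
    simp [hu, S.B_self x hx, S.B_self y hy]
  let g : V →ₗ[K] V := LinearMap.id + (l • S.B u).smulRight u
  have hg : ∀ v, g v = v + (l * S.B u v) • u := fun v => by simp [g]
  refine ⟨g, ⟨fun v => ?_, fun v w => ?_⟩, ?_, fun v hv => ?_⟩
  · have hN : l * S.B u v * S.σ (l * S.B u v) * S.B x y = l * S.B u v * S.B v u := by
      rw [S.symm u v, map_mul]
      linear_combination (S.B u v * S.σ (S.B u v)) * hll
    rw [hg, S.q_add, S.q_smul, hqu, mul_neg, ← S.T_norm, hN]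
    simp
  · simp only [hg, map_add, map_smulₛₗ, LinearMap.add_apply, LinearMap.smul_apply, smul_eq_mul,
      map_mul, hBu, RingHom.id_apply]
    rw [S.symm u v, hxy]
    have h1 : l * S.B y x = 1 := inv_mul_cancel₀ h
    have h2 : S.σ l * S.σ (S.B y x) = 1 := by rw [← map_mul, h1, map_one]
    linear_combination (- S.ε * l * S.B u w * S.σ (S.B u v)) * h2
      - (S.σ l * S.B u w * S.σ (S.B u v)) * h1
  · rw [hg, hu, map_sub, LinearMap.sub_apply, S.B_self x hx, zero_sub, hl, mul_neg,
      inv_mul_cancel₀ h]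
    simp
  · rw [hg, hu, map_sub, LinearMap.sub_apply, hv]
    simp

/-- The Eichler (Siegel) transformation attached to two orthogonal singular vectors. -/
theorem exists_isometry_eichler {e w : V} (he : S.q e = 0) (hw : S.q w = 0) (h : S.B e w = 0) :
    ∃ g, S.IsIsometry g ∧ ∀ v, g v = v - S.B e v • w + (S.ε * S.B w v) • e := by
  let g : V →ₗ[K] V := LinearMap.id - (S.B e).smulRight w + (S.ε • S.B w).smulRight e
  have hg : ∀ v, g v = v - S.B e v • w + (S.ε * S.B w v) • e := fun v => by simp [g]
  have h' : S.B w e = 0 := S.B_eq_zero_comm.1 h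
  have hee := S.B_self e he
  have hww := S.B_self w hw
  refine ⟨g, ⟨fun v => ?_, fun v v' => ?_⟩, hg⟩
  · have hq : S.q (-(S.B e v • w) + (S.ε * S.B w v) • e) = 0 := by
      rw [S.q_add, S.q_neg, S.q_smul, S.q_smul, he, hw]
      simp [h']
    rw [hg, sub_eq_add_neg, add_assoc, S.q_add, hq, map_add (S.B v), map_add S.T, map_neg (S.B v),
      map_neg S.T, map_smul (S.B v), map_smul (S.B v), smul_eq_mul, smul_eq_mul, S.symm e v,
      S.symm w v,
      show S.B e v * (S.ε * S.σ (S.B w v)) = S.ε * (S.B e v * S.σ (S.B w v)) by ring, S.T_ε,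
      show S.ε * S.B w v * (S.ε * S.σ (S.B e v)) = S.ε * (S.ε * (S.B w v * S.σ (S.B e v))) by ring,
      S.T_ε, S.T_ε, ← S.T_σ, map_mul, S.σ_σ, mul_comm (S.σ (S.B e v))]
    ring
  · simp only [hg, map_add, map_sub, map_smulₛₗ, LinearMap.add_apply, LinearMap.sub_apply,
      LinearMap.smul_apply, smul_eq_mul, map_mul, RingHom.id_apply, h, h', hee, hww]
    rw [S.symm e v, S.symm w v, S.σ_ε]
    linear_combination (S.σ (S.B e v) * S.B w v') * S.ε_mul_ε

/-- A vector paired with a singular vector `e` becomes singular after adding a multiple of `e`. -/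
theorem exists_singular_add_smul {e v : V} (he : S.q e = 0) (h : S.B e v = 1) :
    ∃ a : K, S.q (v + a • e) = 0 := by
  obtain ⟨a, ha⟩ := S.T_surj v
  have h' : S.B v e = S.ε := by rw [S.symm e v, h]; simp
  refine ⟨-(S.ε * a), ?_⟩
  rw [S.q_add, S.q_smul, he, map_smul, h', smul_eq_mul,
    show -(S.ε * a) * S.ε = -(a * (S.ε * S.ε)) by ring, S.ε_mul_ε, mul_one, map_neg S.T, ha]
  simp

/-- Any hyperbolic pair can be moved to any other one without moving the vectors orthogonal to
both pairs. -/
theorem exists_isometry_pair {e f e' f' : V} (he : S.q e = 0) (hf : S.q f = 0)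
    (he' : S.q e' = 0) (hf' : S.q f' = 0) (h : S.B e f = 1) (h' : S.B e' f' = 1) :
    ∃ g, S.IsIsometry g ∧ g e = e' ∧ g f = f' ∧
      ∀ v, S.B e v = 0 → S.B f v = 0 → S.B e' v = 0 → S.B f' v = 0 → g v = v := by
  -- First move `e` to a singular vector `w` and `w` to `e'`, where `w` is orthogonal to neither.
  have key : ∀ w, S.q w = 0 → S.B w e ≠ 0 → S.B e' w ≠ 0 →
      (∀ v, S.B e v = 0 → S.B f v = 0 → S.B e' v = 0 → S.B f' v = 0 → S.B w v = 0) →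
      ∃ g, S.IsIsometry g ∧ g e = e' ∧
      ∀ v, S.B e v = 0 → S.B f v = 0 → S.B e' v = 0 → S.B f' v = 0 → g v = v := by
    intro w hw h1 h2 h3
    obtain ⟨g1, hg1, hg1', hg1''⟩ := S.exists_isometry_of_not_orthogonal he hw h1
    obtain ⟨g2, hg2, hg2', hg2''⟩ := S.exists_isometry_of_not_orthogonal hw he' h2
    refine ⟨g2 ∘ₗ g1, hg2.comp hg1, by simp [hg1', hg2'], fun v a b c d => ?_⟩
    have := h3 v a b c d
    rw [LinearMap.comp_apply, hg1'' v (by rw [a, this]), hg2'' v (by rw [c, this])]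
  have step1 : ∃ g, S.IsIsometry g ∧ g e = e' ∧
      ∀ v, S.B e v = 0 → S.B f v = 0 → S.B e' v = 0 → S.B f' v = 0 → g v = v := by
    by_cases h1 : S.B e' e = 0
    · have h1' := S.B_eq_zero_comm.1 h1
      have hfe : S.B f e ≠ 0 := fun h0 => by simp [S.B_eq_zero_comm.1 h0] at h
      by_cases h2 : S.B e' f = 0
      · by_cases h3 : S.B e f' = 0
        · have h4 : S.B e (f + f') = 1 := by simp [h, h3]
          obtain ⟨a, ha⟩ := S.exists_singular_add_smul he h4
          refine key _ ha ?_ ?_ ?_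
          · rw [Ne, S.B_eq_zero_comm]
            simp [h, h3, S.B_self e he]
          · simp [h2, h', h1]
          · intro v a b c d
            simp [a, b, d]
        · refine key f' hf' (fun h0 => h3 (S.B_eq_zero_comm.1 h0)) (by simp [h']) ?_
          intro v _ _ _ d
          exact d
      · exact key f hf hfe h2 fun v _ b _ _ => b
    · obtain ⟨g, hg, hg', hg''⟩ := S.exists_isometry_of_not_orthogonal he he' h1
      exact ⟨g, hg, hg', fun v a _ c _ => hg'' v (by rw [a, c])⟩
  obtain ⟨g, hg, hge, hgv⟩ := step1
  -- Then move the image of `f` to `f'` while fixing `e'`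
  set f1 := g f with hf1
  have hqf1 : S.q f1 = 0 := by rw [hf1, hg.1, hf]
  have hef1 : S.B e' f1 = 1 := by rw [← hge, hf1, hg.2, h]
  have hf1e : S.B f1 e' = S.ε := by rw [S.symm, hef1]; simp
  have hf'e : S.B f' e' = S.ε := by rw [S.symm, h']; simp
  have step2 : ∃ g, S.IsIsometry g ∧ g e' = e' ∧ g f1 = f' ∧
      ∀ v, S.B e' v = 0 → S.B f1 v = 0 → S.B f' v = 0 → g v = v := by
    by_cases h1 : S.B f' f1 = 0
    · have h1' := S.B_eq_zero_comm.1 h1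
      have hw : S.q (f1 - f') = 0 := by
        rw [sub_eq_add_neg, S.q_add, S.q_neg, hqf1, hf']; simp [h1']
      have hew : S.B e' (f1 - f') = 0 := by simp [hef1, h']
      obtain ⟨g, hg, hg'⟩ := S.exists_isometry_eichler he' hw hew
      refine ⟨g, hg, ?_, ?_, fun v a b c => ?_⟩
      · rw [hg', S.B_self e' he', S.B_eq_zero_comm.1 hew]; simp
      · rw [hg', hef1]; simp [S.B_self f1 hqf1, h1]
      · rw [hg', a]; simp [b, c]
    · obtain ⟨g, hg, hg', hg''⟩ := S.exists_isometry_of_not_orthogonal hqf1 hf' h1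
      exact ⟨g, hg, hg'' _ (by rw [hf1e, hf'e]), hg', fun v _ b c => hg'' v (by rw [b, c])⟩
  obtain ⟨g', hg', hg'e, hg'f, hg'v⟩ := step2
  refine ⟨g' ∘ₗ g, hg'.comp hg, by simp [hge, hg'e], by simp [← hf1, hg'f], fun v a b c d => ?_⟩
  have hv := hgv v a b c d
  have : S.B f1 v = 0 := by rw [hf1, ← hv, hg.2, b]
  rw [LinearMap.comp_apply, hv, hg'v v c this d]

/-! ### Hyperbolic frames and Witt's theorem -/

/-- A hyperbolic frame: mutually orthogonal hyperbolic pairs `(a i, b i)`. -/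
structure IsFrame {ι : Type*} (a b : ι → V) : Prop where
  qa : ∀ i, S.q (a i) = 0
  qb : ∀ i, S.q (b i) = 0
  aa : ∀ i j, S.B (a i) (a j) = 0
  bb : ∀ i j, S.B (b i) (b j) = 0
  self : ∀ i, S.B (a i) (b i) = 1
  ab : ∀ i j, i ≠ j → S.B (a i) (b j) = 0

/-- The isometries act transitively on the frames of a given size; this is the part of Witt's
theorem that the classification of geodesics needs. -/
theorem IsFrame.exists_isometry {ι : Type*} [Finite ι] {a b a' b' : ι → V}
    (h : S.IsFrame a b) (h' : S.IsFrame a' b') :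
    ∃ g, S.IsIsometry g ∧ (∀ i, g (a i) = a' i) ∧ ∀ i, g (b i) = b' i := by
  classical
  have := Fintype.ofFinite ι
  suffices H : ∀ s : Finset ι, ∃ g, S.IsIsometry g ∧ (∀ i ∈ s, g (a i) = a' i) ∧
      ∀ i ∈ s, g (b i) = b' i by
    obtain ⟨g, hg, h1, h2⟩ := H Finset.univ
    exact ⟨g, hg, fun i => h1 i (Finset.mem_univ i), fun i => h2 i (Finset.mem_univ i)⟩
  intro s
  induction s using Finset.induction_on with
  | empty => exact ⟨_, S.isIsometry_id, by simp, by simp⟩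
  | insert i s hi ih =>
    obtain ⟨g, hg, ha, hb⟩ := ih
    obtain ⟨g', hg', ha', hb', hv⟩ := S.exists_isometry_pair (e := g (a i)) (f := g (b i))
      (by rw [hg.1, h.qa]) (by rw [hg.1, h.qb]) (h'.qa i) (h'.qb i) (by rw [hg.2, h.self])
      (h'.self i)
    have hne : ∀ j ∈ s, i ≠ j := fun j hj hij => hi (hij ▸ hj)
    refine ⟨g' ∘ₗ g, hg'.comp hg, fun j hj => ?_, fun j hj => ?_⟩
    · rcases Finset.mem_insert.1 hj with rfl | hj
      · exact ha'
      · rw [LinearMap.comp_apply, ha j hj]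
        refine hv _ ?_ ?_ (h'.aa _ _) (S.B_eq_zero_comm.1 (h'.ab _ _ (hne j hj).symm))
        · rw [← ha j hj, hg.2, h.aa]
        · rw [← ha j hj, hg.2]
          exact S.B_eq_zero_comm.1 (h.ab _ _ (hne j hj).symm)
    · rcases Finset.mem_insert.1 hj with rfl | hj
      · exact hb'
      · rw [LinearMap.comp_apply, hb j hj]
        refine hv _ ?_ ?_ (h'.ab _ _ (hne j hj)) (h'.bb _ _)
        · rw [← hb j hj, hg.2, h.ab _ _ (hne j hj)]
        · rw [← hb j hj, hg.2, h.bb]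

/-- A singular subspace: `q` and `B` vanish on it. -/
def IsSing (U : Submodule K V) : Prop := ∀ u ∈ U, S.q u = 0 ∧ ∀ v ∈ U, S.B u v = 0

theorem isSing_span {s : Set V} (hq : ∀ x ∈ s, S.q x = 0) (hB : ∀ x ∈ s, ∀ y ∈ s, S.B x y = 0) :
    S.IsSing (Submodule.span K s) := by
  have h1 : ∀ x ∈ s, ∀ y ∈ Submodule.span K s, S.B x y = 0 := by
    intro x hx y hy
    induction hy using Submodule.span_induction with
    | mem y hy => exact hB x hx y hy
    | zero => simp
    | add y z _ _ h1 h2 => simp [h1, h2]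
    | smul c y _ h => simp [h]
  have h2 : ∀ x ∈ Submodule.span K s, ∀ y ∈ Submodule.span K s, S.B x y = 0 := by
    intro x hx y hy
    induction hx using Submodule.span_induction with
    | mem x hx => exact h1 x hx y hy
    | zero => simp
    | add y z _ _ h1 h2 => simp [h1, h2]
    | smul c y _ h => simp [h]
  intro x hx
  refine ⟨?_, h2 x hx⟩
  induction hx using Submodule.span_induction with
  | mem x hx => exact hq x hx
  | zero => exact S.q_zero
  | add y z hy hz ihy ihz => simp [S.q_add, ihy, ihz, h2 y hy z hz]
  | smul c y _ h => simp [S.q_smul, h]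

/-- A functional on independent vectors spanning a singular subspace is given by the form. -/
theorem exists_dual [FiniteDimensional K V] {ι : Type*} [Finite ι] {a : ι → V}
    (hli : LinearIndependent K a) (hq : ∀ i, S.q (a i) = 0) (hB : ∀ i j, S.B (a i) (a j) = 0)
    (t : ι → K) : ∃ d, ∀ i, S.B (a i) d = t i := by
  classical
  have := Fintype.ofFinite ι
  let F : V →ₗ[K] (ι → K) := LinearMap.pi fun i => S.B (a i)
  suffices h : F.range = ⊤ by
    obtain ⟨d, hd⟩ := LinearMap.range_eq_top.1 h t
    exact ⟨d, fun i => congrFun hd i⟩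
  by_contra hne
  obtain ⟨φ, hφ, hφ'⟩ := Submodule.exists_le_ker_of_lt_top F.range (lt_top_iff_ne_top.2 hne)
  -- `φ` is a linear relation between the functionals `B (a i)`
  set c : ι → K := fun i => φ (Pi.single i 1) with hc
  have hφc : ∀ x, φ x = ∑ i, c i * x i := by
    intro x
    conv_lhs => rw [← Finset.univ_sum_single x]
    rw [map_sum]
    refine Finset.sum_congr rfl fun i _ => ?_
    rw [hc, show Pi.single i (x i) = x i • (Pi.single i 1 : ι → K) by
      rw [← Pi.single_smul]; simp, map_smul, smul_eq_mul, mul_comm]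
  set w := ∑ i, S.σ (c i) • a i with hw
  have hsing := S.isSing_span (s := Set.range a) (by rintro _ ⟨i, rfl⟩; exact hq i)
    (by rintro _ ⟨i, rfl⟩ _ ⟨j, rfl⟩; exact hB i j)
  have hwm : w ∈ Submodule.span K (Set.range a) :=
    Submodule.sum_mem _ fun i _ => Submodule.smul_mem _ _ (Submodule.subset_span ⟨i, rfl⟩)
  have hw0 : w = 0 := by
    refine S.nondeg w (hsing w hwm).1 fun y => ?_
    have : φ (F y) = 0 := hφ' ⟨y, rfl⟩
    rw [hφc] at this
    simpa [hw, F, S.σ_σ] using this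
  have hc0 := Fintype.linearIndependent_iff.1 hli _ hw0
  refine hφ (LinearMap.ext fun x => ?_)
  rw [hφc]
  have : ∀ i, c i = 0 := fun i => by simpa using hc0 i
  simp [this]

/-- A basis of a singular subspace, some of whose vectors already have hyperbolic partners, can be
completed to a hyperbolic frame. -/
theorem exists_frame [FiniteDimensional K V] {ι : Type*} [Finite ι] {a b : ι → V} {s : Set ι}
    (hli : LinearIndependent K a) (hq : ∀ i, S.q (a i) = 0) (hB : ∀ i j, S.B (a i) (a j) = 0)
    (hqb : ∀ i ∈ s, S.q (b i) = 0) (hbb : ∀ i ∈ s, ∀ j ∈ s, S.B (b i) (b j) = 0)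
    (hself : ∀ i ∈ s, S.B (a i) (b i) = 1)
    (hab : ∀ i, ∀ j ∈ s, i ≠ j → S.B (a i) (b j) = 0) :
    ∃ b' : ι → V, S.IsFrame a b' ∧ ∀ i ∈ s, b' i = b i := by
  classical
  have := Fintype.ofFinite ι
  suffices H : ∀ t : Finset ι, ∃ b' : ι → V, (∀ i ∈ s, b' i = b i) ∧
      (∀ i ∈ s ∪ t, S.q (b' i) = 0) ∧
      (∀ i ∈ s ∪ t, ∀ j ∈ s ∪ t, S.B (b' i) (b' j) = 0) ∧ (∀ i ∈ s ∪ t, S.B (a i) (b' i) = 1) ∧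
      (∀ i, ∀ j ∈ s ∪ t, i ≠ j → S.B (a i) (b' j) = 0) by
    obtain ⟨b', h0, h1, h2, h3, h4⟩ := H Finset.univ
    simp only [Finset.coe_univ, Set.union_univ, Set.mem_univ, true_imp_iff] at h1 h2 h3 h4
    exact ⟨b', ⟨hq, h1, hB, h2, h3, h4⟩, h0⟩
  intro t
  induction t using Finset.induction_on with
  | empty =>
    refine ⟨b, fun _ _ => rfl, ?_⟩
    simpa using ⟨hqb, hbb, hself, hab⟩
  | insert i t hi ih =>
    obtain ⟨b', h0, h1, h2, h3, h4⟩ := ih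
    rw [Finset.coe_insert, Set.union_insert]
    by_cases his : i ∈ s ∪ (t : Set ι)
    · rw [Set.insert_eq_of_mem his]
      exact ⟨b', h0, h1, h2, h3, h4⟩
    · obtain ⟨d, hd⟩ := S.exists_dual hli hq hB (Pi.single i 1)
      -- Make the dual vector orthogonal to the partners found so far, then make it singular.
      set d1 := d - ∑ j, (if j ∈ s ∪ (t : Set ι) then S.ε * S.B (b' j) d else 0) • a j with hd1
      have hd1a : ∀ j, S.B (a j) d1 = Pi.single (M := fun _ => K) i 1 j := by
        intro j
        simp only [hd1, map_sub, map_sum, map_smul, hB, hd, smul_zero, Finset.sum_const_zero,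
          sub_zero]
      have hd1b : ∀ j ∈ s ∪ (t : Set ι), S.B (b' j) d1 = 0 := by
        intro j hj
        have hba : ∀ l, S.B (b' j) (a l) = if l = j then S.ε else 0 := by
          intro l
          split_ifs with h
          · rw [h, S.symm, h3 j hj]; simp
          · rw [S.B_eq_zero_comm, h4 l j hj h]
        simp only [hd1, map_sub, map_sum, map_smul, hba, smul_eq_mul, mul_ite, mul_zero,
          Finset.sum_ite_eq', Finset.mem_univ, if_true, if_pos hj]
        linear_combination (- S.B (b' j) d) * S.ε_mul_ε
      obtain ⟨c, hc⟩ := S.exists_singular_add_smul (hq i) (v := d1) (by simp [hd1a])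
      set d2 := d1 + c • a i with hd2
      have hd2a : ∀ j, S.B (a j) d2 = Pi.single (M := fun _ => K) i 1 j := by
        intro j
        simp [hd2, hB, hd1a]
      have hd2b : ∀ j ∈ s ∪ (t : Set ι), S.B (b' j) d2 = 0 := by
        intro j hj
        have : S.B (b' j) (a i) = 0 :=
          S.B_eq_zero_comm.1 (h4 i j hj (fun h => his (h ▸ hj)))
        simp [hd2, hd1b j hj, this]
      have hne : ∀ j ∈ s ∪ (t : Set ι), j ≠ i := fun j hj h => his (h ▸ hj)
      refine ⟨Function.update b' i d2, fun j hj => ?_, ?_, ?_, ?_, ?_⟩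
      · rw [Function.update_of_ne (hne j (Or.inl hj)), h0 j hj]
      · rintro j (rfl | hj)
        · simpa using hc
        · rw [Function.update_of_ne (hne j hj), h1 j hj]
      · rintro j (rfl | hj) l (rfl | hl)
        · simpa using S.B_self _ hc
        · rw [Function.update_of_ne (hne l hl), Function.update_self, S.B_eq_zero_comm, hd2b l hl]
        · rw [Function.update_of_ne (hne j hj), Function.update_self, hd2b j hj]
        · rw [Function.update_of_ne (hne j hj), Function.update_of_ne (hne l hl), h2 j hj l hl]
      · rintro j (rfl | hj)
        · simp [hd2a]
        · rw [Function.update_of_ne (hne j hj), h3 j hj]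
      · rintro j l (rfl | hl) hjl
        · simp [hd2a, hjl]
        · rw [Function.update_of_ne (hne l hl), h4 j l hl hjl]

theorem IsFrame.linearIndependent {ι : Type*} {a b : ι → V} (h : S.IsFrame a b) :
    LinearIndependent K (Sum.elim a b) := by
  classical
  rw [linearIndependent_iff']
  intro s c hc i hi
  rcases i with i | i
  · have h1 : S.B (b i) (∑ j ∈ s, c j • Sum.elim a b j) = S.ε * c (Sum.inl i) := by
      rw [map_sum, Finset.sum_eq_single_of_mem _ hi]
      · have : S.B (b i) (a i) = S.ε := by rw [S.symm, h.self]; simp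
        simp [this, mul_comm]
      · rintro (j | j) _ hj
        · have : S.B (b i) (a j) = 0 := S.B_eq_zero_comm.1 (h.ab j i (by rintro rfl; exact hj rfl))
          simp [this]
        · simp [h.bb]
    rw [hc] at h1
    simpa [S.ε_ne_zero] using h1.symm
  · have h1 : S.B (a i) (∑ j ∈ s, c j • Sum.elim a b j) = c (Sum.inr i) := by
      rw [map_sum, Finset.sum_eq_single_of_mem _ hi]
      · simp [h.self]
      · rintro (j | j) _ hj
        · simp [h.aa]
        · simp [h.ab i j (by rintro rfl; exact hj rfl)]
    rw [hc] at h1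
    simpa using h1.symm

end PolarData

namespace FormedSpace

variable {K V : Type*} [Field K] [AddCommGroup V] [Module K V]

/-- The polar data of a formed space. -/
def toPolarData : FormedSpace K V → PolarData K V
  | symplectic B alt nd =>
    { σ := RingHom.id K
      ε := -1
      B := B
      q := 0
      T := 0
      σ_σ := fun _ => rfl
      σ_ε := rfl
      ε_mul_ε := by simp
      symm := fun x y => by simpa using (LinearMap.IsAlt.neg alt x y).symm
      q_add := by simp
      q_smul := by simp
      T_norm := by simp
      T_ε := by simp
      T_σ := by simp
      T_surj := fun _ => ⟨0, rfl⟩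
      B_self := fun x _ => alt x
      nondeg := fun x _ h => nd.1 x h }
  | orthogonal Q nd =>
    { σ := RingHom.id K
      ε := 1
      B := QuadraticMap.polarBilin Q
      q := Q
      T := AddMonoidHom.id K
      σ_σ := fun _ => rfl
      σ_ε := rfl
      ε_mul_ε := by simp
      symm := fun x y => by simpa using QuadraticMap.polar_comm Q y x
      q_add := fun x y => QuadraticMap.map_add Q x y
      q_smul := fun a x => by simpa using QuadraticMap.map_smul Q a x
      T_norm := by simp
      T_ε := by simp
      T_σ := by simp
      T_surj := fun x => ⟨Q x, rfl⟩
      B_self := fun x hx => by simp [hx]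
      nondeg := fun x hx h => by
        have : x ∈ Q.radical := ⟨hx, LinearMap.ext h⟩
        rw [nd.radical_eq_bot] at this
        simpa using this }
  | unitary σ invol nontriv B herm nd =>
    { σ := σ
      ε := 1
      B := B
      q := fun x => B x x
      T := AddMonoidHom.id K + σ.toAddMonoidHom
      σ_σ := invol
      σ_ε := map_one σ
      ε_mul_ε := by simp
      symm := fun x y => by simpa using (herm.eq x y).symm
      q_add := fun x y => by simp [herm.eq x y]; ring
      q_smul := fun a x => by simp; ring
      T_norm := fun a c => by simp [invol]; ring
      T_ε := by simp
      T_σ := fun c => by simp [invol, add_comm]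
      T_surj := fun x => by
        have hfix : σ (B x x) = B x x := herm.eq x x
        obtain ⟨a, ha⟩ : ∃ a, a + σ a ≠ 0 := by
          by_contra! h
          obtain ⟨a, ha⟩ := nontriv
          have h1 := h 1
          have h2 := h a
          rw [map_one] at h1
          exact ha (by linear_combination h2 - a * h1)
        refine ⟨a * ((a + σ a)⁻¹ * B x x), ?_⟩
        simp only [AddMonoidHom.add_apply, AddMonoidHom.id_apply, RingHom.toAddMonoidHom_eq_coe,
          AddMonoidHom.coe_coe, map_mul, map_inv₀, map_add, invol, hfix, add_comm (σ a) a]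
        field_simp
      B_self := fun x hx => hx
      nondeg := fun x _ h => nd.1 x h }

theorem form_eq (W : FormedSpace K V) (x y : V) : W.form x y = W.toPolarData.B x y := by
  cases W <;> rfl

theorem isSingular_iff (W : FormedSpace K V) (U : Submodule K V) :
    W.IsSingular U ↔ W.toPolarData.IsSing U := by
  cases W with
  | symplectic B alt nd => exact ⟨fun h u hu => ⟨rfl, h u hu⟩, fun h u hu => (h u hu).2⟩
  | orthogonal Q nd =>
    refine ⟨fun h u hu => ⟨h u hu, fun v hv => ?_⟩, fun h u hu => (h u hu).1⟩
    change Q (u + v) - Q u - Q v = 0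
    rw [h u hu, h v hv, h _ (U.add_mem hu hv)]
    simp
  | unitary σ invol nontriv B herm nd =>
    exact ⟨fun h u hu => ⟨h u hu u hu, h u hu⟩, fun h u hu => (h u hu).2⟩

end FormedSpace

/-! ### The normal form of a walk -/

theorem Submodule.exists_sub_smul_mem_of_finrank_inf {K V : Type*} [Field K] [AddCommGroup V]
    [Module K V] [FiniteDimensional K V]
    {A B : Submodule K V} (h : finrank K B ≤ finrank K (A ⊓ B : Submodule K V) + 1)
    {x : V} (hx : x ∈ B) (hxA : x ∉ A) {y : V} (hy : y ∈ B) : ∃ c : K, y - c • x ∈ A ⊓ B := by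
  have hle : (A ⊓ B) ⊔ K ∙ x ≤ B := sup_le inf_le_right (by simpa using hx)
  have hlt : A ⊓ B < (A ⊓ B) ⊔ K ∙ x := by
    refine lt_of_le_of_ne le_sup_left fun heq => hxA ?_
    have : x ∈ (A ⊓ B) ⊔ K ∙ x := Submodule.mem_sup_right (Submodule.mem_span_singleton_self x)
    rw [← heq] at this
    exact this.1
  have hfin := Submodule.finrank_lt_finrank_of_lt hlt
  have heq := Submodule.eq_of_le_of_finrank_le hle (by omega)
  rw [← heq] at hy
  obtain ⟨a, ha, b, hb, rfl⟩ := Submodule.mem_sup.1 hy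
  obtain ⟨c, rfl⟩ := Submodule.mem_span_singleton.1 hb
  exact ⟨c, by simpa using ha⟩

namespace PolarData

variable {K V : Type*} [Field K] [AddCommGroup V] [Module K V] (S : PolarData K V)

theorem IsSing.mono {S : PolarData K V} {U U' : Submodule K V} (h : S.IsSing U) (hle : U' ≤ U) :
    S.IsSing U' := fun u hu => ⟨(h u (hle hu)).1, fun v hv => (h u (hle hu)).2 v (hle hv)⟩

/-- A walk `Y 0, …, Y m` in the polar Grassmann graph on the singular `k`-subspaces, given by a
sequence of subspaces of which only the first `m + 1` terms matter. -/
structure IsWalk (k m : ℕ) (Y : ℕ → Submodule K V) : Prop where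
  finrank_eq : ∀ i ≤ m, finrank K (Y i) = k
  sing : ∀ i < m, S.IsSing (Y i ⊔ Y (i + 1))
  finrank_inf : ∀ i < m, finrank K (Y i ⊓ Y (i + 1) : Submodule K V) + 1 = k

/-- The walk `Y 0, …, Y m` exchanges vectors one by one: `Y i` is spanned by a common subspace `U`,
the vectors `e l` with `i ≤ l < m` and the vectors `f j` with `j < i`, so that step `i` replaces
`e i` by `f i`. The matrix of the form between the `e l` and the `f j` has entries `0` and `1`, and
at most one `1` in each row and column.

The code `c` records this matrix: `c j = 0` if `f j` is orthogonal to every `e l`, and `c j = l + 1`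
if `e l` is its partner. As `Y j ⊔ Y (j + 1)` is singular, `l < j` in the second case. -/
structure IsPreNormal (m : ℕ) (Y : ℕ → Submodule K V) (U : Submodule K V) (e f : ℕ → V)
    (c : ℕ → ℕ) : Prop where
  eq_sup : ∀ i ≤ m,
    Y i = U ⊔ Submodule.span K (e '' Set.Ico i m) ⊔ Submodule.span K (f '' Set.Iio i)
  form : ∀ l < m, ∀ j < m, S.B (e l) (f j) = if c j = l + 1 then 1 else 0
  le : ∀ j < m, c j ≤ j
  inj : ∀ i j, i < j → j < m → c i = c j → c i = 0

variable {S}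

theorem IsPreNormal.le_finrank_add {k m : ℕ} {Y : ℕ → Submodule K V} {U : Submodule K V}
    {e f : ℕ → V} {c : ℕ → ℕ} [FiniteDimensional K V] (h : S.IsPreNormal m Y U e f c)
    (hk : finrank K (Y 0) = k) : k ≤ finrank K U + m := by
  classical
  have h1 : finrank K (Submodule.span K (e '' Set.Ico 0 m)) ≤ m := by
    have := finrank_span_finset_le_card (R := K) ((Finset.Ico 0 m).image e)
    rw [Finset.coe_image, Finset.coe_Ico] at this
    exact this.trans (Finset.card_image_le.trans (by simp))
  have h2 := Submodule.finrank_add_le_finrank_add_finrank U (Submodule.span K (e '' Set.Ico 0 m))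
  have hI : Set.Iio (0 : ℕ) = ∅ := by ext; simp
  rw [h.eq_sup 0 (Nat.zero_le _), hI, Set.image_empty, Submodule.span_empty, sup_bot_eq] at hk
  omega

/-- The induction step of the normal form. The last step of the walk leaves some vector `x` of `U`
and enters some vector `g`. Every `f j` is first changed by a multiple of `x` so as to lie in
`Y (m + 1)`; elimination on the row of products of `g` with the `e l` then leaves at most one
nonzero entry, in a column that is not yet matched. -/
theorem IsPreNormal.exists_succ [FiniteDimensional K V] {k m : ℕ} {Y : ℕ → Submodule K V}
    {U : Submodule K V} {e f : ℕ → V} {c : ℕ → ℕ} (h : S.IsPreNormal m Y U e f c)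
    (hw : S.IsWalk k (m + 1) Y)
    (hd : finrank K (Y 0 ⊓ Y (m + 1) : Submodule K V) + (m + 1) ≤ k) :
    ∃ U' e' f' c', S.IsPreNormal (m + 1) Y U' e' f' c' := by
  classical
  have hUm : U ≤ Y m := by rw [h.eq_sup m le_rfl, sup_assoc]; exact le_sup_left
  have hU0 : U ≤ Y 0 := by rw [h.eq_sup 0 (Nat.zero_le _), sup_assoc]; exact le_sup_left
  have he0 : ∀ l < m, e l ∈ Y 0 := by
    intro l hl
    rw [h.eq_sup 0 (Nat.zero_le _)]
    exact Submodule.mem_sup_left (Submodule.mem_sup_right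
      (Submodule.subset_span ⟨l, ⟨Nat.zero_le _, hl⟩, rfl⟩))
  have hfm : ∀ j < m, f j ∈ Y m := by
    intro j hj
    rw [h.eq_sup m le_rfl]
    exact Submodule.mem_sup_right (Submodule.subset_span ⟨j, hj, rfl⟩)
  have hs0 : S.IsSing (Y 0) := (hw.sing 0 (Nat.succ_pos _)).mono le_sup_left
  have hsm := hw.sing m (Nat.lt_succ_self m)
  have hinf := hw.finrank_inf m (Nat.lt_succ_self m)
  have hkm := hw.finrank_eq m (Nat.le_succ m)
  have hkm1 := hw.finrank_eq (m + 1) le_rfl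
  -- A vector of `U` outside `Y (m + 1)`
  have hUk := h.le_finrank_add (hw.finrank_eq 0 (Nat.zero_le _))
  obtain ⟨x, hxU, hx⟩ : ∃ x ∈ U, x ∉ Y (m + 1) := by
    by_contra! hcon
    have : U ≤ Y 0 ⊓ Y (m + 1) := le_inf hU0 hcon
    have := Submodule.finrank_mono this
    omega
  have hproj : ∀ y ∈ Y m, ∃ t : K, y - t • x ∈ Y (m + 1) := by
    intro y hy
    obtain ⟨t, ht⟩ := Submodule.exists_sub_smul_mem_of_finrank_inf (A := Y (m + 1)) (B := Y m)
      (by rw [inf_comm]; omega) (hUm hxU) hx hy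
    exact ⟨t, ht.1⟩
  choose! t ht using hproj
  -- A vector of `Y (m + 1)` outside `Y m`
  obtain ⟨g, hg, hgm⟩ : ∃ g ∈ Y (m + 1), g ∉ Y m := by
    by_contra! hcon
    have : Y (m + 1) ≤ Y m ⊓ Y (m + 1) := le_inf hcon le_rfl
    have := Submodule.finrank_mono this
    omega
  set f1 : ℕ → V := fun j => f j - t (f j) • x with hf1
  have hf1m : ∀ j < m, f1 j ∈ Y m := fun j hj =>
    (Y m).sub_mem (hfm j hj) ((Y m).smul_mem _ (hUm hxU))
  have hf1m1 : ∀ j < m, f1 j ∈ Y (m + 1) := fun j hj => ht _ (hfm j hj)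
  have hef1 : ∀ l < m, ∀ j < m, S.B (e l) (f1 j) = if c j = l + 1 then 1 else 0 := by
    intro l hl j hj
    have : S.B (e l) x = 0 := (hs0 _ (he0 l hl)).2 x (hU0 hxU)
    simp only [hf1, map_sub, map_smul, this, h.form l hl j hj, smul_zero, sub_zero]
  -- Clear the entries of the new row in the columns that are already matched.
  set g1 : V := g - ∑ j ∈ Finset.range m, S.B (e (c j - 1)) g • f1 j with hg1
  have hg1m1 : g1 ∈ Y (m + 1) := (Y (m + 1)).sub_mem hg (Submodule.sum_mem _ fun j hj =>
    (Y (m + 1)).smul_mem _ (hf1m1 j (Finset.mem_range.1 hj)))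
  have hg1m : g1 ∉ Y m := by
    intro hcon
    refine hgm ?_
    have := (Y m).add_mem hcon (Submodule.sum_mem (Y m) fun j hj =>
      (Y m).smul_mem (S.B (e (c j - 1)) g) (hf1m j (Finset.mem_range.1 hj)))
    simpa [hg1] using this
  have hg1e : ∀ j < m, ∀ l < m, c j = l + 1 → S.B (e l) g1 = 0 := by
    intro j hj l hl hjl
    have : ∑ i ∈ Finset.range m, S.B (e l) (S.B (e (c i - 1)) g • f1 i) =
        S.B (e l) g := by
      rw [Finset.sum_eq_single_of_mem j (Finset.mem_range.2 hj)]
      · simp [hef1 l hl j hj, hjl]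
      · intro i hi hij
        have hi := Finset.mem_range.1 hi
        have : c i ≠ l + 1 := by
          intro hil
          rcases lt_or_gt_of_ne hij with hlt | hlt
          · have := h.inj i j hlt hj (by omega); omega
          · have := h.inj j i hlt hi (by omega); omega
        simp [hef1 l hl i hi, this]
    rw [hg1, map_sub, map_sum, this, sub_self]
  -- The new vector `fm`, its code `cm`, and the coefficients `a` of the column operations. The
  -- pivot `l0` is the last nonzero entry, so that only vectors `e l` with `l < l0` are changed, by
  -- multiples of `e l0`; this respects the spans in `eq_sup`, which lose the `e l` in increasing
  -- order.
  obtain ⟨fm, hfm1, hfmm, cm, hcm, hcmj, l0, a, ha, hfme⟩ : ∃ fm ∈ Y (m + 1), fm ∉ Y m ∧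
      ∃ cm ≤ m, (∀ j < m, c j = cm → c j = 0) ∧ ∃ (l0 : ℕ) (a : ℕ → K),
        (∀ l, a l ≠ 0 → l < l0 ∧ l0 < m ∧ ∀ j < m, c j ≠ l0 + 1) ∧
        ∀ l < m, S.B (e l - a l • e l0) fm = if cm = l + 1 then 1 else 0 := by
    by_cases hz : ∃ l < m, S.B (e l) g1 ≠ 0
    · set P : ℕ → Prop := fun l => l < m ∧ S.B (e l) g1 ≠ 0
      obtain ⟨l1, hl1⟩ := hz
      set l0 := Nat.findGreatest P m
      have hl0 : P l0 := Nat.findGreatest_spec hl1.1.le hl1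
      have hmax : ∀ l < m, l0 < l → S.B (e l) g1 = 0 := by
        intro l hl hlt
        by_contra hne
        exact Nat.findGreatest_is_greatest hlt hl.le ⟨hl, hne⟩
      have hunm : ∀ j < m, c j ≠ l0 + 1 := fun j hj hjl => hl0.2 (hg1e j hj l0 hl0.1 hjl)
      refine ⟨(S.B (e l0) g1)⁻¹ • g1, Submodule.smul_mem _ _ hg1m1, ?_, l0 + 1, hl0.1,
        fun j hj hjl => absurd hjl (hunm j hj), l0,
        fun l => if l < l0 then S.σ ((S.B (e l0) g1)⁻¹ * S.B (e l) g1) else 0, ?_, ?_⟩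
      · rwa [Submodule.smul_mem_iff _ (inv_ne_zero hl0.2)]
      · intro l hl
        refine ⟨?_, hl0.1, hunm⟩
        by_contra hcon
        simp [hcon] at hl
      · intro l hl
        beta_reduce
        have h1 : (S.B (e l0) g1)⁻¹ * S.B (e l0) g1 = 1 := inv_mul_cancel₀ hl0.2
        rcases lt_trichotomy l l0 with hlt | rfl | hlt
        · rw [if_pos hlt, if_neg (by omega)]
          rw [map_sub, LinearMap.sub_apply, map_smul, map_smul, map_smulₛₗ, LinearMap.smul_apply,
            S.σ_σ, smul_eq_mul, smul_eq_mul, smul_eq_mul]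
          linear_combination (-(S.B (e l0) g1)⁻¹ * S.B (e l) g1) * h1
        · simp [h1]
        · rw [if_neg (by omega), if_neg (by omega)]
          simp [hmax l hl hlt]
    · push Not at hz
      refine ⟨g1, hg1m1, hg1m, 0, Nat.zero_le _, fun j hj hj0 => hj0, 0, 0, by simp, ?_⟩
      intro l hl
      simp [hz l hl]
  set e' : ℕ → V := fun l => if l < m then e l - a l • e l0 else x with he'
  set f' : ℕ → V := fun j => if j < m then f1 j else fm with hf'
  have he'l : ∀ l < m, e' l = e l - a l • e l0 := fun l hl => if_pos hl
  have he'm : e' m = x := if_neg (lt_irrefl m)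
  have hf'j : ∀ j < m, f' j = f1 j := fun j hj => if_pos hj
  have hf'm : f' m = fm := if_neg (lt_irrefl m)
  set N : ℕ → Submodule K V := fun i => U ⊓ Y (m + 1) ⊔
    Submodule.span K (e' '' Set.Ico i (m + 1)) ⊔ Submodule.span K (f' '' Set.Iio i) with hN
  have hNU : ∀ i, U ⊓ Y (m + 1) ≤ N i := fun i => le_sup_left.trans le_sup_left
  have hNe : ∀ i l, i ≤ l → l < m + 1 → e' l ∈ N i := fun i l hl hl' =>
    Submodule.mem_sup_left (Submodule.mem_sup_right (Submodule.subset_span ⟨l, ⟨hl, hl'⟩, rfl⟩))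
  have hNf : ∀ i j, j < i → f' j ∈ N i := fun i j hj =>
    Submodule.mem_sup_right (Submodule.subset_span ⟨j, hj, rfl⟩)
  have hfeq : ∀ j, f j = f1 j + t (f j) • x := fun j => by simp [hf1]
  refine ⟨U ⊓ Y (m + 1), e', f', fun j => if j < m then c j else cm, ?_, ?_, ?_, ?_⟩
  · intro i hi
    change Y i = N i
    rcases Nat.lt_or_ge m i with him | him
    · obtain rfl : i = m + 1 := by omega
      have hle : N (m + 1) ≤ Y (m + 1) := by
        refine sup_le (sup_le inf_le_right ?_) (Submodule.span_le.2 ?_)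
        · simp
        · rintro _ ⟨j, hj, rfl⟩
          rcases Nat.lt_succ_iff_lt_or_eq.1 hj with hj | rfl
          · rw [hf'j j hj]; exact hf1m1 j hj
          · rw [hf'm]; exact hfm1
      refine le_antisymm (fun y hy => ?_) hle
      have hfin : finrank K (Y (m + 1)) ≤ finrank K (Y m ⊓ Y (m + 1) : Submodule K V) + 1 := by
        omega
      obtain ⟨b, hb⟩ := Submodule.exists_sub_smul_mem_of_finrank_inf hfin hfm1 hfmm hy
      have hYm : Y m ≤ K ∙ x ⊔ N (m + 1) := by
        have hxx : x ∈ K ∙ x ⊔ N (m + 1) :=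
          Submodule.mem_sup_left (Submodule.mem_span_singleton_self x)
        rw [h.eq_sup m le_rfl]
        refine sup_le (sup_le (fun u hu => ?_) (by simp)) (Submodule.span_le.2 ?_)
        · rw [← sub_add_cancel u (t u • x)]
          refine Submodule.add_mem _ (Submodule.mem_sup_right (hNU _ ⟨?_, ht u (hUm hu)⟩))
            (Submodule.smul_mem _ _ hxx)
          exact U.sub_mem hu (U.smul_mem _ hxU)
        · rintro _ ⟨j, hj, rfl⟩
          rw [hfeq j, ← hf'j j hj]
          exact Submodule.add_mem _ (Submodule.mem_sup_right (hNf _ _ (Nat.lt_succ_of_lt hj)))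
            (Submodule.smul_mem _ _ hxx)
      obtain ⟨p, hp, n, hn, hpn⟩ := Submodule.mem_sup.1 (hYm hb.1)
      obtain ⟨r, rfl⟩ := Submodule.mem_span_singleton.1 hp
      have hr : r = 0 := by
        by_contra hr
        have h1 : r • x ∈ Y (m + 1) := by
          rw [eq_sub_of_add_eq hpn]
          exact Submodule.sub_mem _ hb.2 (hle hn)
        exact hx ((Submodule.smul_mem_iff _ hr).1 h1)
      rw [hr, zero_smul, zero_add] at hpn
      rw [← sub_add_cancel y (b • fm), ← hpn, ← hf'm]
      exact Submodule.add_mem _ hn (Submodule.smul_mem _ _ (hNf _ _ (Nat.lt_succ_self m)))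
    · have hxN : x ∈ N i := he'm ▸ hNe i m him (Nat.lt_succ_self m)
      rw [h.eq_sup i him]
      have hYe : ∀ l, i ≤ l → l < m → e l ∈ Y i := fun l hl hl' => by
        rw [h.eq_sup i him]
        exact Submodule.mem_sup_left (Submodule.mem_sup_right
          (Submodule.subset_span ⟨l, ⟨hl, hl'⟩, rfl⟩))
      have hUi : U ≤ Y i := by rw [h.eq_sup i him, sup_assoc]; exact le_sup_left
      rw [← h.eq_sup i him]
      apply le_antisymm
      · rw [h.eq_sup i him]
        refine sup_le (sup_le (fun u hu => ?_) (Submodule.span_le.2 ?_)) (Submodule.span_le.2 ?_)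
        · rw [← sub_add_cancel u (t u • x)]
          refine Submodule.add_mem _ (hNU _ ⟨?_, ht u (hUm hu)⟩) (Submodule.smul_mem _ _ hxN)
          exact U.sub_mem hu (U.smul_mem _ hxU)
        · rintro _ ⟨l, ⟨hl, hl'⟩, rfl⟩
          have h1 := hNe i l hl (Nat.lt_succ_of_lt hl')
          rw [he'l l hl'] at h1
          by_cases hal : a l = 0
          · simpa [hal] using h1
          · obtain ⟨h2, h3, _⟩ := ha l hal
            have h4 := hNe i l0 (hl.trans h2.le) (Nat.lt_succ_of_lt h3)
            have h5 : a l0 = 0 := by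
              by_contra h5
              exact lt_irrefl _ (ha l0 h5).1
            rw [he'l l0 h3, h5, zero_smul, sub_zero] at h4
            rw [← sub_add_cancel (e l) (a l • e l0)]
            exact Submodule.add_mem _ h1 (Submodule.smul_mem _ _ h4)
        · rintro _ ⟨j, hj, rfl⟩
          rw [hfeq j, ← hf'j j (lt_of_lt_of_le hj him)]
          exact Submodule.add_mem _ (hNf _ _ hj) (Submodule.smul_mem _ _ hxN)
      · refine sup_le (sup_le (inf_le_left.trans hUi) (Submodule.span_le.2 ?_))
          (Submodule.span_le.2 ?_)
        · rintro _ ⟨l, ⟨hl, hl'⟩, rfl⟩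
          rcases Nat.lt_succ_iff_lt_or_eq.1 hl' with hl' | rfl
          · rw [he'l l hl']
            refine Submodule.sub_mem _ (hYe l hl hl') ?_
            by_cases hal : a l = 0
            · simp [hal]
            · obtain ⟨h2, h3, _⟩ := ha l hal
              exact Submodule.smul_mem _ _ (hYe l0 (hl.trans h2.le) h3)
          · rw [he'm]; exact hUi hxU
        · rintro _ ⟨j, hj, rfl⟩
          have hjm : j < m := lt_of_lt_of_le hj him
          rw [hf'j j hjm]
          refine Submodule.sub_mem _ ?_ (Submodule.smul_mem _ _ (hUi hxU))
          rw [h.eq_sup i him]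
          exact Submodule.mem_sup_right (Submodule.subset_span ⟨j, hj, rfl⟩)
  · intro l hl j hj
    rcases Nat.lt_succ_iff_lt_or_eq.1 hl with hlm | rfl
    · rcases Nat.lt_succ_iff_lt_or_eq.1 hj with hjm | rfl
      · rw [he'l l hlm, hf'j j hjm, if_pos hjm]
        have : S.B (a l • e l0) (f1 j) = 0 := by
          by_cases hal : a l = 0
          · simp [hal]
          · obtain ⟨_, h3, h4⟩ := ha l hal
            simp [hef1 l0 h3 j hjm, h4 j hjm]
        rw [map_sub S.B, LinearMap.sub_apply, this, sub_zero, hef1 l hlm j hjm]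
      · rw [he'l l hlm, hf'm, hfme l hlm, if_neg (lt_irrefl _)]
    · have hxm := hsm x (Submodule.mem_sup_left (hUm hxU))
      rcases Nat.lt_succ_iff_lt_or_eq.1 hj with hjm | rfl
      · have := h.le j hjm
        rw [he'm, hf'j j hjm, if_pos hjm, hxm.2 _ (Submodule.mem_sup_left (hf1m j hjm)),
          if_neg (by omega)]
      · rw [he'm, hf'm, if_neg (lt_irrefl _), hxm.2 _ (Submodule.mem_sup_right hfm1),
          if_neg (by omega)]
  · intro j hj
    split_ifs with hjm
    · exact h.le j hjm
    · omega
  · intro i j hij hj hc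
    beta_reduce at hc ⊢
    rw [if_pos (by omega)] at hc ⊢
    split_ifs at hc with hjm
    · exact h.inj i j hij hjm hc
    · exact hcmj i (by omega) hc

/-- Along a walk the intersection with the first vertex loses at most one dimension per step. -/
theorem IsWalk.finrank_inf_zero [FiniteDimensional K V] {k m : ℕ} {Y : ℕ → Submodule K V}
    (hw : S.IsWalk k m Y) {i j : ℕ} (hij : i ≤ j) (hj : j ≤ m) :
    finrank K (Y 0 ⊓ Y i : Submodule K V) + i ≤ finrank K (Y 0 ⊓ Y j : Submodule K V) + j := by
  induction j, hij using Nat.le_induction with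
  | base => exact le_rfl
  | succ j hij ih =>
    have h1 := ih (by omega)
    have h2 := Submodule.finrank_sup_add_finrank_inf_eq (Y 0 ⊓ Y j) (Y j ⊓ Y (j + 1))
    have h3 := Submodule.finrank_mono
      (sup_le inf_le_right inf_le_left : (Y 0 ⊓ Y j) ⊔ (Y j ⊓ Y (j + 1)) ≤ Y j)
    have h4 := Submodule.finrank_mono
      (le_inf (inf_le_left.trans inf_le_left) (inf_le_right.trans inf_le_right) :
        (Y 0 ⊓ Y j) ⊓ (Y j ⊓ Y (j + 1)) ≤ Y 0 ⊓ Y (j + 1))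
    have h5 := hw.finrank_inf j (by omega)
    have h6 := hw.finrank_eq j (by omega)
    omega

theorem IsWalk.of_le {k m n : ℕ} {Y : ℕ → Submodule K V} (hw : S.IsWalk k m Y) (h : n ≤ m) :
    S.IsWalk k n Y :=
  ⟨fun i hi => hw.finrank_eq i (hi.trans h), fun i hi => hw.sing i (by omega),
    fun i hi => hw.finrank_inf i (by omega)⟩

/-- A walk whose ends meet in codimension at least its length has a normal form. -/
theorem IsWalk.exists_isPreNormal [FiniteDimensional K V] {k m : ℕ} {Y : ℕ → Submodule K V}
    (hw : S.IsWalk k m Y) (hd : finrank K (Y 0 ⊓ Y m : Submodule K V) + m ≤ k) :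
    ∃ U e f c, S.IsPreNormal m Y U e f c := by
  induction m with
  | zero => exact ⟨Y 0, 0, 0, 0, by simp, by simp, by simp, by simp⟩
  | succ m ih =>
    have := hw.finrank_inf_zero (Nat.le_add_right m 1) le_rfl
    obtain ⟨U, e, f, c, h⟩ := ih (hw.of_le (Nat.le_succ m)) (by omega)
    exact h.exists_succ hw hd

end PolarData

theorem LinearIndependent.finrank_span_image {K V ι : Type*} [Field K] [AddCommGroup V]
    [Module K V] {v : ι → V} (hv : LinearIndependent K v) (s : Finset ι) :
    finrank K (Submodule.span K (v '' s)) = s.card := by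
  have := finrank_span_eq_card (hv.comp (fun x : s => (x : ι)) Subtype.val_injective)
  rw [Fintype.card_coe] at this
  have hset : Set.range (v ∘ fun x : s => (x : ι)) = v '' s := by
    ext x
    simp
  rw [← hset, this]

namespace PolarData

variable {K V : Type*} [Field K] [AddCommGroup V] [Module K V] (S : PolarData K V)

/-- The basis version of `IsPreNormal`: the singular vectors `e l` (`l < k`) and `f j` (`j < m`) are
independent, `Y i` has the basis `e i, …, e (k - 1), f 0, …, f (i - 1)`, and the form on these
vectors is given by the code `c`, with `c j = 0` if `f j` has no partner and `c j = l + 1` if its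
partner is `e l`. Values of `e`, `f`, `c` outside these ranges are irrelevant. -/
structure IsNormal (k m : ℕ) (Y : ℕ → Submodule K V) (e f : ℕ → V) (c : ℕ → ℕ) : Prop where
  li : LinearIndependent K (Sum.elim (fun l : Fin k => e l) (fun j : Fin m => f j))
  eq_span : ∀ i ≤ m, Y i = Submodule.span K (e '' Set.Ico i k ∪ f '' Set.Iio i)
  qe : ∀ l < k, S.q (e l) = 0
  qf : ∀ j < m, S.q (f j) = 0
  ee : ∀ l < k, ∀ l' < k, S.B (e l) (e l') = 0
  ff : ∀ j < m, ∀ j' < m, S.B (f j) (f j') = 0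
  ef : ∀ l < k, ∀ j < m, S.B (e l) (f j) = if c j = l + 1 then 1 else 0
  le : ∀ j < m, c j ≤ j
  inj : ∀ i j, i < j → j < m → c i = c j → c i = 0

/-- The vectors orthogonal to a subspace. -/
def perp (U : Submodule K V) : Submodule K V where
  carrier := {v | ∀ u ∈ U, S.B u v = 0}
  add_mem' := fun {x y} hx hy u hu => by simp [hx u hu, hy u hu]
  zero_mem' := fun u _ => by simp
  smul_mem' := fun c x hx u hu => by simp [hx u hu]

variable {S}

theorem mem_perp_span {s : Set V} {v : V} :
    v ∈ S.perp (Submodule.span K s) ↔ ∀ u ∈ s, S.B u v = 0 := by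
  refine ⟨fun h u hu => h u (Submodule.subset_span hu), fun h u hu => ?_⟩
  induction hu using Submodule.span_induction with
  | mem u hu => exact h u hu
  | zero => simp
  | add y z _ _ h1 h2 => simp [h1, h2]
  | smul c y _ h => simp [h]

theorem IsWalk.isSing {k m : ℕ} {Y : ℕ → Submodule K V} (hw : S.IsWalk k m Y) (hm : 1 ≤ m) {i : ℕ}
    (hi : i ≤ m) : S.IsSing (Y i) := by
  rcases Nat.lt_or_ge i m with h | h
  · exact (hw.sing i h).mono le_sup_left
  · obtain ⟨j, rfl⟩ := Nat.exists_eq_add_of_le' hm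
    obtain rfl : i = j + 1 := by omega
    exact (hw.sing j (Nat.lt_succ_self j)).mono le_sup_right

/-- If the ends of the walk meet in codimension exactly `m`, a basis of `U` completes the vectors
`e l` to a basis of `Y 0`, and the vectors of the normal form are independent. -/
theorem IsPreNormal.exists_isNormal [FiniteDimensional K V] {k m : ℕ} {Y : ℕ → Submodule K V}
    {U : Submodule K V} {e f : ℕ → V} {c : ℕ → ℕ} (h : S.IsPreNormal m Y U e f c)
    (hw : S.IsWalk k m Y) (hm : 1 ≤ m)
    (hd : finrank K (Y 0 ⊓ Y m : Submodule K V) + m ≤ k) :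
    ∃ e' f', S.IsNormal k m Y e' f' c := by
  classical
  have hUi : ∀ i ≤ m, U ≤ Y i := fun i hi => by
    rw [h.eq_sup i hi, sup_assoc]; exact le_sup_left
  have hUinf := Submodule.finrank_mono (le_inf (hUi 0 (Nat.zero_le _)) (hUi m le_rfl))
  have hUk := h.le_finrank_add (hw.finrank_eq 0 (Nat.zero_le _))
  have hU : finrank K U = k - m := by omega
  let b := finBasisOfFinrankEq K U hU
  set e' : ℕ → V := fun l => if l < m then e l else
    if hl : l - m < k - m then (b ⟨l - m, hl⟩ : V) else 0 with he'
  have he'l : ∀ l < m, e' l = e l := fun l hl => if_pos hl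
  have he'm : ∀ l (_ : m ≤ l) (_ : l < k), e' l = b ⟨l - m, by omega⟩ := fun l hl hl' => by
    rw [he']
    beta_reduce
    rw [if_neg (by omega), dif_pos]
  have he'U : ∀ l, m ≤ l → l < k → e' l ∈ U := fun l hl hl' => by
    rw [he'm l hl hl']; exact Subtype.mem _
  have hspan : ∀ i ≤ m, Y i = Submodule.span K (e' '' Set.Ico i k ∪ f '' Set.Iio i) := by
    intro i hi
    apply le_antisymm
    · rw [h.eq_sup i hi]
      refine sup_le (sup_le (fun u hu => ?_) (Submodule.span_le.2 ?_)) (Submodule.span_le.2 ?_)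
      · have : u = ∑ x, b.repr ⟨u, hu⟩ x • (b x : V) := by
          conv_lhs => rw [show u = ((⟨u, hu⟩ : U) : V) from rfl, ← b.sum_repr ⟨u, hu⟩]
          simp only [AddSubmonoidClass.coe_finsetSum, Submodule.coe_smul]
        rw [this]
        refine Submodule.sum_mem _ fun x _ => Submodule.smul_mem _ _ (Submodule.subset_span
          (Or.inl ⟨m + x, ⟨by omega, by omega⟩, ?_⟩))
        rw [he'm _ (by omega) (by omega)]
        congr 2
        ext
        simp
      · rintro _ ⟨l, ⟨hl, hl'⟩, rfl⟩
        rw [← he'l l hl']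
        exact Submodule.subset_span (Or.inl ⟨l, ⟨hl, by omega⟩, rfl⟩)
      · rintro _ ⟨j, hj, rfl⟩
        exact Submodule.subset_span (Or.inr ⟨j, hj, rfl⟩)
    · refine Submodule.span_le.2 ?_
      rintro _ (⟨l, ⟨hl, hl'⟩, rfl⟩ | ⟨j, hj, rfl⟩)
      · rcases Nat.lt_or_ge l m with hlm | hlm
        · rw [h.eq_sup i hi, he'l l hlm]
          exact Submodule.mem_sup_left (Submodule.mem_sup_right
            (Submodule.subset_span ⟨l, ⟨hl, hlm⟩, rfl⟩))
        · exact hUi i hi (he'U l hlm hl')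
      · rw [h.eq_sup i hi]
        exact Submodule.mem_sup_right (Submodule.subset_span ⟨j, hj, rfl⟩)
  have he0 : ∀ l < k, e' l ∈ Y 0 := fun l hl => by
    rw [hspan 0 (Nat.zero_le _)]
    exact Submodule.subset_span (Or.inl ⟨l, ⟨Nat.zero_le _, hl⟩, rfl⟩)
  have hfm : ∀ j < m, f j ∈ Y m := fun j hj => by
    rw [hspan m le_rfl]
    exact Submodule.subset_span (Or.inr ⟨j, hj, rfl⟩)
  have hs0 := hw.isSing hm (Nat.zero_le m)
  have hsm := hw.isSing hm (le_refl m)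
  refine ⟨e', f, ?_, hspan, fun l hl => (hs0 _ (he0 l hl)).1, fun j hj => (hsm _ (hfm j hj)).1,
    fun l hl l' hl' => (hs0 _ (he0 l hl)).2 _ (he0 l' hl'),
    fun j hj j' hj' => (hsm _ (hfm j hj)).2 _ (hfm j' hj'), fun l hl j hj => ?_, h.le, h.inj⟩
  · rw [linearIndependent_iff_card_eq_finrank_span, Set.finrank]
    have hsup : Submodule.span K (Set.range (Sum.elim (fun l : Fin k => e' l)
        (fun j : Fin m => f j))) = Y 0 ⊔ Y m := by
      apply le_antisymm
      · refine Submodule.span_le.2 ?_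
        rintro _ ⟨l | j, rfl⟩
        · exact Submodule.mem_sup_left (he0 l l.2)
        · exact Submodule.mem_sup_right (hfm j j.2)
      · rw [hspan 0 (Nat.zero_le _), hspan m le_rfl, ← Submodule.span_union]
        refine Submodule.span_mono ?_
        rintro _ ((⟨l, ⟨_, hl⟩, rfl⟩ | ⟨j, hj, rfl⟩) | (⟨l, ⟨_, hl⟩, rfl⟩ | ⟨j, hj, rfl⟩))
        · exact ⟨Sum.inl ⟨l, hl⟩, rfl⟩
        · simp at hj
        · exact ⟨Sum.inl ⟨l, hl⟩, rfl⟩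
        · exact ⟨Sum.inr ⟨j, hj⟩, rfl⟩
    rw [hsup]
    have h1 := Submodule.finrank_sup_add_finrank_inf_eq (Y 0) (Y m)
    have h2 := hw.finrank_eq 0 (Nat.zero_le _)
    have h3 := hw.finrank_eq m le_rfl
    simp only [Fintype.card_sum, Fintype.card_fin]
    omega
  · rcases Nat.lt_or_ge l m with hlm | hlm
    · rw [he'l l hlm, h.form l hlm j hj]
    · have := h.le j hj
      rw [if_neg (by omega)]
      exact (hsm _ (hUi m le_rfl (he'U l hlm hl))).2 _ (hfm j hj)

namespace IsNormal

variable {k m : ℕ} {Y : ℕ → Submodule K V} {e f : ℕ → V} {c : ℕ → ℕ}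

theorem finrank_span (h : S.IsNormal k m Y e f c) {s t : Finset ℕ} (hs : ∀ l ∈ s, l < k)
    (ht : ∀ j ∈ t, j < m) :
    finrank K (Submodule.span K (e '' s ∪ f '' t)) = s.card + t.card := by
  classical
  have := h.li.finrank_span_image ((s.attachFin hs).disjSum (t.attachFin ht))
  rw [Finset.card_disjSum, Finset.card_attachFin, Finset.card_attachFin] at this
  rw [← this]
  refine congrArg (fun s => finrank K (Submodule.span K s)) (Set.ext fun x => ?_)
  constructor
  · rintro (⟨l, hl, rfl⟩ | ⟨j, hj, rfl⟩)
    · exact ⟨Sum.inl ⟨l, hs l hl⟩, by simpa using hl, rfl⟩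
    · exact ⟨Sum.inr ⟨j, ht j hj⟩, by simpa using hj, rfl⟩
  · rintro ⟨l | j, hl, rfl⟩
    · exact Or.inl ⟨l, by simpa using hl, rfl⟩
    · exact Or.inr ⟨j, by simpa using hl, rfl⟩

/-- The intersection of `Y i` with the orthogonal space of an earlier `Y i'` is spanned by the `e l`
in `Y i` and those `f j` in `Y i` whose partner is not in `Y i'`. -/
theorem finrank_inf_perp (h : S.IsNormal k m Y e f c) (hmk : m ≤ k) {i i' : ℕ} (hi : i ≤ m)
    (hii : i' ≤ i) :
    finrank K (Y i ⊓ S.perp (Y i') : Submodule K V) +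
      ((Finset.range i).filter fun j => i' < c j).card = k := by
  classical
  have key : Y i ⊓ S.perp (Y i') = Submodule.span K
      (e '' (Finset.Ico i k : Finset ℕ) ∪ f '' ((Finset.range i).filter fun j => ¬ i' < c j :
        Finset ℕ)) := by
    rw [h.eq_span i hi, h.eq_span i' (hii.trans hi)]
    apply le_antisymm
    · rintro y ⟨hy, hy'⟩
      have hy' := mem_perp_span.1 hy'
      rw [SetLike.mem_coe, Submodule.span_union] at hy
      obtain ⟨y1, hy1, y2, hy2, rfl⟩ := Submodule.mem_sup.1 hy
      rw [Submodule.span_union]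
      refine Submodule.add_mem_sup (by simpa using hy1) ?_
      rw [show Set.Iio i = ((Finset.range i : Finset ℕ) : Set ℕ) by ext; simp] at hy2
      obtain ⟨β, rfl⟩ := (Submodule.mem_span_image_finset_iff_exists_fun' K).1 hy2
      refine Submodule.sum_mem _ fun j hj => ?_
      by_cases hc : i' < c j
      · have hji := Finset.mem_range.1 hj
        have hjc := h.le j (by omega)
        have h1 := hy' (e (c j - 1)) (Or.inl ⟨c j - 1, ⟨by omega, by omega⟩, rfl⟩)
        have h2 : S.B (e (c j - 1)) y1 = 0 := by
          have : Submodule.span K (e '' Set.Ico i k) ≤ LinearMap.ker (S.B (e (c j - 1))) := by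
            refine Submodule.span_le.2 ?_
            rintro _ ⟨l, ⟨_, hl⟩, rfl⟩
            exact h.ee _ (by omega) _ hl
          exact this hy1
        rw [map_add, h2, zero_add, map_sum, Finset.sum_eq_single_of_mem j hj] at h1
        · rw [map_smul, h.ef _ (by omega) _ (by omega), if_pos (by omega), smul_eq_mul,
            mul_one] at h1
          rw [h1, zero_smul]
          exact Submodule.zero_mem _
        · intro b hb hbj
          have hb := Finset.mem_range.1 hb
          rw [map_smul, h.ef _ (by omega) _ (by omega), if_neg, smul_zero]
          intro hcb
          rcases lt_or_gt_of_ne hbj with hlt | hlt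
          · have := h.inj b j hlt (by omega) (by omega); omega
          · have := h.inj j b hlt (by omega) (by omega); omega
      · exact Submodule.smul_mem _ _ (Submodule.subset_span
          ⟨j, by simpa using ⟨Finset.mem_range.1 hj, not_lt.1 hc⟩, rfl⟩)
    · refine Submodule.span_le.2 ?_
      rintro _ (⟨l, hl, rfl⟩ | ⟨j, hj, rfl⟩)
      · obtain ⟨hl, hl'⟩ := Finset.mem_Ico.1 (Finset.mem_coe.1 hl)
        refine ⟨Submodule.subset_span (Or.inl ⟨l, ⟨hl, hl'⟩, rfl⟩), mem_perp_span.2 ?_⟩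
        rintro _ (⟨l', ⟨_, hl2⟩, rfl⟩ | ⟨j, hj, rfl⟩)
        · exact h.ee _ hl2 _ hl'
        · have hj : j < i' := hj
          have := h.le j (by omega)
          rw [S.B_eq_zero_comm, h.ef _ hl' _ (by omega), if_neg (by omega)]
      · obtain ⟨hj, hj'⟩ := Finset.mem_filter.1 (Finset.mem_coe.1 hj)
        have hj := Finset.mem_range.1 hj
        refine ⟨Submodule.subset_span (Or.inr ⟨j, hj, rfl⟩), mem_perp_span.2 ?_⟩
        rintro _ (⟨l', ⟨hl1, hl2⟩, rfl⟩ | ⟨j', hj2, rfl⟩)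
        · rw [h.ef _ hl2 _ (by omega), if_neg (by omega)]
        · have hj2 : j' < i' := hj2
          exact h.ff _ (by omega) _ (by omega)
  rw [key, h.finrank_span]
  · have := Finset.card_filter_add_card_filter_not (s := Finset.range i) (fun j => i' < c j)
    rw [Finset.card_range] at this
    rw [Nat.card_Ico]
    omega
  · intro l hl
    exact (Finset.mem_Ico.1 hl).2
  · intro j hj
    have := Finset.mem_range.1 (Finset.mem_filter.1 hj).1
    omega

/-- `X 0` together with the unmatched `f j` spans a singular subspace. -/
theorem exists_isSing (h : S.IsNormal k m Y e f c) :
    ∃ U, S.IsSing U ∧ finrank K U = k + ((Finset.range m).filter fun j => c j = 0).card := by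
  refine ⟨Submodule.span K (e '' (Finset.range k : Finset ℕ) ∪
    f '' ((Finset.range m).filter fun j => c j = 0 : Finset ℕ)), S.isSing_span ?_ ?_, ?_⟩
  · rintro _ (⟨l, hl, rfl⟩ | ⟨j, hj, rfl⟩)
    · exact h.qe l (by simpa using hl)
    · exact h.qf j (by simp at hj; exact hj.1)
  · have hef : ∀ l < k, ∀ j, j < m ∧ c j = 0 → S.B (e l) (f j) = 0 := fun l hl j hj => by
      rw [h.ef l hl j hj.1, if_neg (by omega)]
    rintro _ (⟨l, hl, rfl⟩ | ⟨j, hj, rfl⟩) _ (⟨l', hl', rfl⟩ | ⟨j', hj', rfl⟩)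
    · exact h.ee _ (by simpa using hl) _ (by simpa using hl')
    · exact hef _ (by simpa using hl) _ (by simpa using hj')
    · exact S.B_eq_zero_comm.1 (hef _ (by simpa using hl') _ (by simpa using hj))
    · exact h.ff _ (by simp at hj; exact hj.1) _ (by simp at hj'; exact hj'.1)
  · rw [h.finrank_span, Finset.card_range]
    · simp
    · intro j hj
      simpa using (Finset.mem_filter.1 hj).1

/-- Walks with equal codes are related by an isometry: the vectors of the normal form lie in a
hyperbolic frame, in which the partners of `e l` and of the unmatched `f j` are added where missing,
and frames of equal size are related by an isometry. -/
theorem exists_isometry [FiniteDimensional K V] (h : S.IsNormal k m Y e f c) (hmk : m ≤ k)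
    {Y' : ℕ → Submodule K V}
    {e' f' : ℕ → V} {c' : ℕ → ℕ} (h' : S.IsNormal k m Y' e' f' c') (hc : ∀ j < m, c j = c' j) :
    ∃ g, S.IsIsometry g ∧ ∀ i ≤ m, (Y i).map g = Y' i := by
  classical
  let J := Fin k ⊕ {j : Fin m // c j = 0}
  let s : Set J := {x | ∃ l : Fin k, x = Sum.inl l ∧ ∃ j < m, c j = l + 1}
  have key : ∀ {Y : ℕ → Submodule K V} {e f : ℕ → V} {c' : ℕ → ℕ}, S.IsNormal k m Y e f c' →
      (∀ j < m, c j = c' j) → ∃ a b : J → V, S.IsFrame a b ∧ (∀ l : Fin k, a (Sum.inl l) = e l) ∧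
      (∀ j, a (Sum.inr j) = f j.1) ∧ (∀ l : Fin k, ∀ j < m, c j = l + 1 → b (Sum.inl l) = f j) := by
    intro Y e f c' h hc
    let a : J → V := Sum.elim (fun l => e l) (fun j => f j.1)
    let b : J → V := Sum.elim (fun l => if hl : ∃ j < m, c j = l + 1 then f hl.choose else 0) 0
    have hb : ∀ l : Fin k, ∀ j < m, c j = l + 1 → b (Sum.inl l) = f j := by
      intro l j hj hjl
      have hex : ∃ j < m, c j = l + 1 := ⟨j, hj, hjl⟩
      have h1 : b (Sum.inl l) = f hex.choose := dif_pos hex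
      obtain ⟨h2, h3⟩ := hex.choose_spec
      have h4 : hex.choose = j := by
        have h5 := hc _ h2
        have h6 := hc _ hj
        by_contra hne
        rcases lt_or_gt_of_ne hne with hlt | hlt
        · have := h.inj _ _ hlt hj (by omega); omega
        · have := h.inj _ _ hlt h2 (by omega); omega
      rw [h1, h4]
    have hli : LinearIndependent K a := by
      have := h.li.comp (Sum.map id Subtype.val : J → Fin k ⊕ Fin m)
        (Sum.map_injective.2 ⟨Function.injective_id, Subtype.val_injective⟩)
      convert this using 1
      ext x
      rcases x with l | j <;> rfl
    have hef : ∀ l : Fin k, ∀ j : {j : Fin m // c j = 0}, S.B (e l) (f j.1) = 0 := fun l j => by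
      rw [h.ef l l.2 j.1 j.1.2, if_neg]
      rw [← hc _ j.1.2, j.2]
      omega
    suffices hfr : ∃ b' : J → V, S.IsFrame a b' ∧ ∀ i ∈ s, b' i = b i by
      obtain ⟨b', hb', hb''⟩ := hfr
      refine ⟨a, b', hb', fun _ => rfl, fun _ => rfl, fun l j hj hjl => ?_⟩
      rw [hb'' _ ⟨l, rfl, j, hj, hjl⟩, hb l j hj hjl]
    refine S.exists_frame hli ?_ ?_ ?_ ?_ ?_ ?_
    · rintro (l | j)
      · exact h.qe l l.2
      · exact h.qf j.1 j.1.2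
    · rintro (l | j) (l' | j')
      · exact h.ee l l.2 l' l'.2
      · exact hef l j'
      · exact S.B_eq_zero_comm.1 (hef l' j)
      · exact h.ff j.1 j.1.2 j'.1 j'.1.2
    · rintro _ ⟨l, rfl, j, hj, hjl⟩
      rw [hb l j hj hjl]
      exact h.qf j hj
    · rintro _ ⟨l, rfl, j, hj, hjl⟩ _ ⟨l', rfl, j', hj', hjl'⟩
      rw [hb l j hj hjl, hb l' j' hj' hjl']
      exact h.ff j hj j' hj'
    · rintro _ ⟨l, rfl, j, hj, hjl⟩
      rw [hb l j hj hjl]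
      change S.B (e l) (f j) = 1
      rw [h.ef l l.2 j hj, ← hc j hj, if_pos hjl]
    · rintro (l' | j') _ ⟨l, rfl, j, hj, hjl⟩ hne
      · rw [hb l j hj hjl]
        change S.B (e l') (f j) = 0
        rw [h.ef l' l'.2 j hj, ← hc j hj, if_neg]
        intro h1
        apply hne
        congr 1
        ext
        omega
      · rw [hb l j hj hjl]
        exact h.ff j'.1 j'.1.2 j hj
  obtain ⟨a, b, hab, ha1, ha2, hb⟩ := key h (fun _ _ => rfl)
  obtain ⟨a', b', hab', ha1', ha2', hb'⟩ := key h' hc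
  obtain ⟨g, hg, hga, hgb⟩ := hab.exists_isometry S hab'
  have hge : ∀ l < k, g (e l) = e' l := fun l hl => by
    have := hga (Sum.inl ⟨l, hl⟩)
    rwa [ha1, ha1'] at this
  have hgf : ∀ j < m, g (f j) = f' j := fun j hj => by
    by_cases hcj : c j = 0
    · have := hga (Sum.inr ⟨⟨j, hj⟩, hcj⟩)
      rwa [ha2, ha2'] at this
    · have hcle := h.le j hj
      have hl : c j - 1 < k := by omega
      have := hgb (Sum.inl ⟨c j - 1, hl⟩)
      rwa [hb ⟨c j - 1, hl⟩ j hj (by simp; omega), hb' ⟨c j - 1, hl⟩ j hj (by simp; omega)] at this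
  refine ⟨g, hg, fun i hi => ?_⟩
  rw [h.eq_span i hi, h'.eq_span i hi, Submodule.map_span, Set.image_union, Set.image_image,
    Set.image_image]
  congr 2
  · exact Set.image_congr fun l hl => hge l hl.2
  · exact Set.image_congr fun j hj => hgf j (lt_of_lt_of_le hj hi)

/-- The code is determined by the ranks of the form between the vertices: the numbers
`#{j < i | i' < c j}` give `c`. -/
theorem code_eq (h : S.IsNormal k m Y e f c) (hmk : m ≤ k) {Y' : ℕ → Submodule K V}
    {e' f' : ℕ → V} {c' : ℕ → ℕ} (h' : S.IsNormal k m Y' e' f' c')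
    (hY : ∀ i i', i' < i → i ≤ m → finrank K (Y i ⊓ S.perp (Y i') : Submodule K V) =
      finrank K (Y' i ⊓ S.perp (Y' i') : Submodule K V)) : ∀ j < m, c j = c' j := by
  have hN : ∀ i i', i' ≤ i → i ≤ m → ((Finset.range i).filter fun j => i' < c j).card =
      ((Finset.range i).filter fun j => i' < c' j).card := by
    intro i i' hi hm
    rcases hi.lt_or_eq with hlt | rfl
    · have h1 := h.finrank_inf_perp hmk hm hi
      have h2 := h'.finrank_inf_perp hmk hm hi
      have h3 := hY i i' hlt hm
      omega
    · rw [Finset.filter_false_of_mem, Finset.filter_false_of_mem]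
      · intro j hj
        have hj := Finset.mem_range.1 hj
        have := h'.le j (by omega)
        omega
      · intro j hj
        have hj := Finset.mem_range.1 hj
        have := h.le j (by omega)
        omega
  intro j hj
  have hiff : ∀ i' ≤ j, i' < c j ↔ i' < c' j := by
    intro i' hi'
    have h1 := hN (j + 1) i' (by omega) hj
    have h2 := hN j i' hi' hj.le
    rw [Finset.range_add_one, Finset.filter_insert, Finset.filter_insert] at h1
    split_ifs at h1 with h3 h4 h4
    · simp [h3, h4]
    · rw [Finset.card_insert_of_notMem (by simp)] at h1; omega
    · rw [Finset.card_insert_of_notMem (by simp)] at h1; omega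
    · simp [h3, h4]
  have h1 := h.le j hj
  have h2 := h'.le j hj
  rcases lt_trichotomy (c j) (c' j) with hlt | heq | hlt
  · have := (hiff (c j) h1).2 hlt; omega
  · exact heq
  · have := (hiff (c' j) h2).1 hlt; omega

end IsNormal

end PolarData

/-! ### Counting subspaces -/

section Subspaces

variable {K V : Type*} [Field K] [AddCommGroup V] [Module K V] [FiniteDimensional K V]

theorem Submodule.exists_finrank_eq_between {A C : Submodule K V} (hAC : A ≤ C) {n : ℕ}
    (hn : finrank K A ≤ n) (hnC : n ≤ finrank K C) :
    ∃ H, A ≤ H ∧ H ≤ C ∧ finrank K H = n := by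
  induction n, hn using Nat.le_induction with
  | base => exact ⟨A, le_rfl, hAC, rfl⟩
  | succ n hn ih =>
    obtain ⟨H, h1, h2, h3⟩ := ih (by omega)
    obtain ⟨x, hx, hxH⟩ : ∃ x ∈ C, x ∉ H := by
      by_contra! hcon
      have := Submodule.finrank_mono (show C ≤ H from hcon)
      omega
    exact ⟨H ⊔ K ∙ x, h1.trans le_sup_left, sup_le h2 (by simpa using hx),
      by rw [finrank_sup_span_singleton hxH, h3]⟩

theorem Submodule.exists_linearEquiv_mem_iff {A C A' C' : Submodule K V} (hAC : A ≤ C)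
    (hAC' : A' ≤ C') (hA : finrank K A = finrank K A') (hC : finrank K C = finrank K C') :
    ∃ φ : C ≃ₗ[K] C', ∀ x : C, (φ x : V) ∈ A' ↔ (x : V) ∈ A := by
  obtain ⟨D, hD⟩ := Submodule.exists_isCompl (A.submoduleOf C)
  obtain ⟨D', hD'⟩ := Submodule.exists_isCompl (A'.submoduleOf C')
  have h1 := (Submodule.submoduleOfEquivOfLe hAC).finrank_eq
  have h2 := (Submodule.submoduleOfEquivOfLe hAC').finrank_eq
  have h3 := Submodule.finrank_add_eq_of_isCompl hD
  have h4 := Submodule.finrank_add_eq_of_isCompl hD'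
  let eA : A.submoduleOf C ≃ₗ[K] A'.submoduleOf C' := LinearEquiv.ofFinrankEq _ _ (by omega)
  let eD : D ≃ₗ[K] D' := LinearEquiv.ofFinrankEq _ _ (by omega)
  refine ⟨(Submodule.prodEquivOfIsCompl _ _ hD).symm ≪≫ₗ (eA.prodCongr eD) ≪≫ₗ
    Submodule.prodEquivOfIsCompl _ _ hD', fun x => ?_⟩
  have h5 : (x : V) ∈ A ↔ ((Submodule.prodEquivOfIsCompl _ _ hD).symm x).2 = 0 := by
    rw [Submodule.prodEquivOfIsCompl_symm_apply_snd_eq_zero]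
    rfl
  set p := (Submodule.prodEquivOfIsCompl _ _ hD).symm x with hp
  have h6 : ∀ z : C', (z : V) ∈ A' ↔ ((Submodule.prodEquivOfIsCompl _ _ hD').symm z).2 = 0 := by
    intro z
    rw [Submodule.prodEquivOfIsCompl_symm_apply_snd_eq_zero]
    rfl
  rw [h5, h6]
  simp [← hp]

/-- The subspaces of dimension `n` between two given ones. -/
def Submodule.between (A C : Submodule K V) (n : ℕ) : Set (Submodule K V) :=
  {L | A ≤ L ∧ L ≤ C ∧ finrank K L = n}

variable [Finite K]

theorem Submodule.finite_of_finite_field (s : Set (Submodule K V)) : s.Finite := by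
  have : Finite V := Module.finite_of_finite K
  exact Set.toFinite s

/-- The number of subspaces of dimension `n` in an interval depends only on the dimensions of its
ends. -/
theorem Submodule.ncard_between_le {A C A' C' : Submodule K V} (hAC : A ≤ C)
    (hAC' : A' ≤ C') (hA : finrank K A = finrank K A') (hC : finrank K C = finrank K C') (n : ℕ) :
    (between A C n).ncard ≤ (between A' C' n).ncard := by
  obtain ⟨φ, hφ⟩ := exists_linearEquiv_mem_iff hAC hAC' hA hC
  have hinj : Function.Injective (C'.subtype ∘ₗ φ.toLinearMap) :=
    C'.injective_subtype.comp φ.injective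
  refine Set.ncard_le_ncard_of_injOn
    (fun L => (L.comap C.subtype).map (C'.subtype ∘ₗ φ.toLinearMap)) ?_ ?_
    (finite_of_finite_field _)
  · rintro L ⟨h1, h2, h3⟩
    refine ⟨fun x hx => ?_, ?_, ?_⟩
    · refine ⟨φ.symm ⟨x, hAC' hx⟩, h1 ((hφ _).1 (by simpa using hx)), by simp⟩
    · rintro _ ⟨x, _, rfl⟩
      exact Subtype.mem _
    · rw [← (Submodule.equivMapOfInjective _ hinj _).finrank_eq, ← Submodule.finrank_map_subtype_eq,
        Submodule.map_comap_subtype, inf_eq_right.2 h2, h3]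
  · rintro L ⟨_, h2, _⟩ L' ⟨_, h2', _⟩ h
    have h := Submodule.map_injective_of_injective hinj h
    have h3 := congrArg (Submodule.map C.subtype) h
    rwa [Submodule.map_comap_subtype, Submodule.map_comap_subtype, inf_eq_right.2 h2,
      inf_eq_right.2 h2'] at h3

theorem Submodule.ncard_between_eq {A C A' C' : Submodule K V} (hAC : A ≤ C)
    (hAC' : A' ≤ C') (hA : finrank K A = finrank K A') (hC : finrank K C = finrank K C') (n : ℕ) :
    (between A C n).ncard = (between A' C' n).ncard :=
  (ncard_between_le hAC hAC' hA hC n).antisymm (ncard_between_le hAC' hAC hA.symm hC.symm n)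

theorem Submodule.ncard_between_pos {A C : Submodule K V} (hAC : A ≤ C) {n : ℕ}
    (hn : finrank K A ≤ n) (hnC : n ≤ finrank K C) : 0 < (between A C n).ncard := by
  obtain ⟨H, hH⟩ := exists_finrank_eq_between hAC hn hnC
  exact (Set.ncard_pos (finite_of_finite_field _)).2 ⟨H, hH⟩

/-- The larger of two quotient spaces has more points. -/
theorem Submodule.ncard_between_lt {A C A' C' : Submodule K V} (hAC : A ≤ C)
    (hAC' : A' ≤ C') (hA : finrank K A = finrank K A') (hC : finrank K C < finrank K C') :
    (between A C (finrank K A + 1)).ncard < (between A' C' (finrank K A + 1)).ncard := by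
  obtain ⟨D, h1, h2, h3⟩ := exists_finrank_eq_between hAC' (hA ▸ Submodule.finrank_mono hAC) hC.le
  rw [ncard_between_eq hAC h1 hA h3.symm]
  refine Set.ncard_lt_ncard ⟨fun L hL => ⟨hL.1, hL.2.1.trans h2, hL.2.2⟩, fun hcon => ?_⟩
    (finite_of_finite_field _)
  obtain ⟨x, hx, hxD⟩ : ∃ x ∈ C', x ∉ D := by
    by_contra! hcon
    have := Submodule.finrank_mono (show C' ≤ D from hcon)
    omega
  have : A' ⊔ K ∙ x ∈ between A' C' (finrank K A + 1) :=
    ⟨le_sup_left, sup_le hAC' (by simpa using hx),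
      by rw [finrank_sup_span_singleton fun h => hxD (h1 h), hA]⟩
  exact hxD ((hcon this).2.1 (Submodule.mem_sup_right (Submodule.mem_span_singleton_self x)))

end Subspaces

/-! ### Orthogonal subspaces -/

namespace PolarData

variable {K V : Type*} [Field K] [AddCommGroup V] [Module K V] (S : PolarData K V)

theorem perp_mono {U U' : Submodule K V} (h : U ≤ U') : S.perp U' ≤ S.perp U :=
  fun _ hv u hu => hv u (h hu)

variable {S} in
theorem IsSing.le_perp {U : Submodule K V} (h : S.IsSing U) : U ≤ S.perp U :=
  fun u hu v hv => (h v hv).2 u hu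

variable {S} in
theorem IsSing.sup {U U' : Submodule K V} (h : S.IsSing U) (h' : S.IsSing U')
    (hUU' : U' ≤ S.perp U) : S.IsSing (U ⊔ U') := by
  rw [← Submodule.span_eq U, ← Submodule.span_eq U', ← Submodule.span_union]
  refine S.isSing_span ?_ ?_
  · rintro x (hx | hx)
    · exact (h x hx).1
    · exact (h' x hx).1
  · rintro x (hx | hx) y (hy | hy)
    · exact (h x hx).2 y hy
    · exact hUU' hy x hx
    · exact S.B_eq_zero_comm.1 (hUU' hx y hy)
    · exact (h' x hx).2 y hy

theorem perp_sup (U U' : Submodule K V) : S.perp (U ⊔ U') = S.perp U ⊓ S.perp U' := by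
  refine le_antisymm (le_inf (S.perp_mono le_sup_left) (S.perp_mono le_sup_right)) ?_
  rintro v ⟨h1, h2⟩ u hu
  obtain ⟨a, ha, b, hb, rfl⟩ := Submodule.mem_sup.1 hu
  simp [h1 a ha, h2 b hb]

variable [FiniteDimensional K V]

/-- `Y` imposes at most `finrank Y` linear conditions on `X`. -/
theorem finrank_le_add_finrank_inf_perp (X Y : Submodule K V) :
    finrank K X ≤ finrank K Y + finrank K (X ⊓ S.perp Y : Submodule K V) := by
  let b := finBasis K Y
  let F : X →ₗ[K] (Fin (finrank K Y) → K) :=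
    LinearMap.pi fun i => (S.B (b i : V)) ∘ₗ X.subtype
  have h1 := F.finrank_range_add_finrank_ker
  have h2 := F.range.finrank_le
  rw [finrank_fin_fun] at h2
  have h3 : F.ker.map X.subtype ≤ X ⊓ S.perp Y := by
    rintro _ ⟨x, hx, rfl⟩
    refine ⟨x.2, fun y hy => ?_⟩
    have h4 : ∀ i, S.B (b i : V) x = 0 := fun i => congrFun hx i
    have h5 : y = ∑ i, b.repr ⟨y, hy⟩ i • (b i : V) := by
      conv_lhs => rw [show y = ((⟨y, hy⟩ : Y) : V) from rfl, ← b.sum_repr ⟨y, hy⟩]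
      simp only [AddSubmonoidClass.coe_finsetSum, Submodule.coe_smul]
    rw [h5]
    simp [h4]
  have h4 := Submodule.finrank_mono h3
  rw [Submodule.finrank_map_subtype_eq] at h4
  omega

theorem finrank_inf_perp_le {X Y : Submodule K V} (h : finrank K X = finrank K Y) :
    finrank K (Y ⊓ S.perp X : Submodule K V) ≤ finrank K (X ⊓ S.perp Y : Submodule K V) := by
  obtain ⟨C, hC⟩ := Submodule.exists_isCompl ((Y ⊓ S.perp X).submoduleOf Y)
  set D := C.map Y.subtype with hD
  have h1 := (Submodule.submoduleOfEquivOfLe (inf_le_left : Y ⊓ S.perp X ≤ Y)).finrank_eq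
  have h2 := Submodule.finrank_add_eq_of_isCompl hC
  have h3 : finrank K D = finrank K C := Submodule.finrank_map_subtype_eq Y C
  have h4 : Y = (Y ⊓ S.perp X) ⊔ D := by
    have := congrArg (Submodule.map Y.subtype) hC.sup_eq_top
    rw [Submodule.map_sup, Submodule.map_top, Submodule.range_subtype, Submodule.submoduleOf,
      Submodule.map_comap_subtype] at this
    rw [hD]
    conv_lhs => rw [← this, ← inf_assoc, inf_idem]
  have h5 : X ⊓ S.perp D ≤ X ⊓ S.perp Y := by
    rintro x ⟨hx, hxD⟩
    refine ⟨hx, ?_⟩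
    rw [h4, perp_sup]
    exact ⟨fun y hy => S.B_eq_zero_comm.1 (hy.2 x hx), hxD⟩
  have h6 := Submodule.finrank_mono h5
  have h7 := S.finrank_le_add_finrank_inf_perp X D
  omega

/-- The rank of the form between two subspaces of equal dimension is symmetric. -/
theorem finrank_inf_perp_comm {X Y : Submodule K V} (h : finrank K X = finrank K Y) :
    finrank K (Y ⊓ S.perp X : Submodule K V) = finrank K (X ⊓ S.perp Y : Submodule K V) :=
  (S.finrank_inf_perp_le h).antisymm (S.finrank_inf_perp_le h.symm)

end PolarData

/-! ### Distances in the polar Grassmann graph -/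

theorem SimpleGraph.exists_walk_of_adj {α : Type*} {G : SimpleGraph α} (Z : ℕ → α) :
    ∀ n, (∀ i < n, G.Adj (Z i) (Z (i + 1))) → ∃ p : G.Walk (Z 0) (Z n), p.length = n
  | 0, _ => ⟨.nil, rfl⟩
  | n + 1, h => by
    obtain ⟨p, hp⟩ := exists_walk_of_adj Z n fun i hi => h i (by omega)
    exact ⟨p.concat (h n (Nat.lt_succ_self n)), by simp [hp]⟩

theorem SimpleGraph.dist_map_iso {α : Type*} {G : SimpleGraph α} (φ : G ≃g G) (x y : α) :
    G.dist (φ x) (φ y) = G.dist x y := by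
  have key : ∀ (φ : G ≃g G) (x y : α), G.Reachable x y → G.dist (φ x) (φ y) ≤ G.dist x y := by
    intro φ x y h
    obtain ⟨p, hp⟩ := h.exists_walk_length_eq_dist
    rw [← hp, ← p.length_map φ.toHom]
    exact SimpleGraph.dist_le _
  by_cases h : G.Reachable x y
  · refine (key φ x y h).antisymm ?_
    have := key φ.symm (φ x) (φ y) (h.map φ.toHom)
    simpa using this
  · rw [SimpleGraph.dist_eq_zero_of_not_reachable h, SimpleGraph.dist_eq_zero_of_not_reachable]
    intro h'
    exact h (by simpa using h'.map φ.symm.toHom)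

namespace FormedSpace

variable {K V : Type*} [Field K] [AddCommGroup V] [Module K V] (W : FormedSpace K V) {k : ℕ}

/-- `Y` is close to `X` when some vector of `Y` outside `X` is orthogonal to `X`; as `X ⊓ Y` is
orthogonal to `X` for singular `X`, this is a comparison of dimensions. For distinct vertices `X`
and `Y` of the same dimension it means that they are not opposite. -/
def Close (X Y : Submodule K V) : Prop :=
  finrank K (X ⊓ Y : Submodule K V) < finrank K (Y ⊓ W.toPolarData.perp X : Submodule K V)

variable {W}

theorem SingularSubspace.isSing (X : W.SingularSubspace k) : W.toPolarData.IsSing X.1 :=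
  (W.isSingular_iff _).1 X.2.1

theorem adj_iff (hk : k < W.wittIndex) {X Y : W.SingularSubspace k} :
    (W.polarGrassmannGraph k).Adj X Y ↔ W.toPolarData.IsSing (X.1 ⊔ Y.1) ∧
      finrank K (X.1 ⊔ Y.1 : Submodule K V) = k + 1 := by
  simp only [polarGrassmannGraph, hk, true_and, hk.ne, false_and, or_false, isSingular_iff]

variable [FiniteDimensional K V]

theorem close_iff_exists {X Y : W.SingularSubspace k} :
    W.Close X.1 Y.1 ↔ ∃ y ∈ Y.1, y ∉ X.1 ∧ y ∈ W.toPolarData.perp X.1 := by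
  have hle : X.1 ⊓ Y.1 ≤ Y.1 ⊓ W.toPolarData.perp X.1 :=
    le_inf inf_le_right (inf_le_left.trans X.isSing.le_perp)
  constructor
  · intro h
    by_contra! hcon
    refine absurd (Submodule.finrank_mono (?_ : Y.1 ⊓ W.toPolarData.perp X.1 ≤ X.1 ⊓ Y.1))
      (not_le.2 h)
    rintro y ⟨h1, h2⟩
    by_contra h3
    exact hcon y h1 (fun h4 => h3 ⟨h4, h1⟩) h2
  · rintro ⟨y, h1, h2, h3⟩
    refine Submodule.finrank_lt_finrank_of_lt (lt_of_le_of_ne hle fun heq => h2 ?_)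
    have : y ∈ Y.1 ⊓ W.toPolarData.perp X.1 := ⟨h1, h3⟩
    rw [← heq] at this
    exact this.1

/-- The relation is symmetric since the rank of the form between `X` and `Y` is. -/
theorem Close.symm {X Y : W.SingularSubspace k} (h : W.Close X.1 Y.1) : W.Close Y.1 X.1 := by
  unfold Close at h ⊢
  rwa [W.toPolarData.finrank_inf_perp_comm (Y.2.2.trans X.2.2.symm), inf_comm]

theorem not_opposite_iff {X Y : W.SingularSubspace k} (hne : X ≠ Y) :
    ¬ W.Opposite X Y ↔ W.Close X.1 Y.1 := by
  rw [close_iff_exists]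
  simp only [Opposite, hne, ne_eq, not_false_eq_true, true_and, not_forall, form_eq]
  constructor
  · rintro ⟨y, h1, h2, h3⟩
    refine ⟨y, h1, h2, fun x hx => ?_⟩
    by_contra h4
    refine h3 ⟨x, hx, fun h5 => h4 ((Y.isSing x h5).2 y h1), h4⟩
  · rintro ⟨y, h1, h2, h3⟩
    exact ⟨y, h1, h2, fun ⟨x, hx, _, h4⟩ => h4 (h3 x hx)⟩

theorem finrank_inf_of_adj (hk : k < W.wittIndex) {X Y : W.SingularSubspace k}
    (h : (W.polarGrassmannGraph k).Adj X Y) :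
    finrank K (X.1 ⊓ Y.1 : Submodule K V) + 1 = k := by
  have h1 := ((adj_iff hk).1 h).2
  have h2 := Submodule.finrank_sup_add_finrank_inf_eq X.1 Y.1
  rw [X.2.2, Y.2.2] at h2
  omega

theorem le_finrank_inf_add_length (hk : k < W.wittIndex) {X Y : W.SingularSubspace k}
    (p : (W.polarGrassmannGraph k).Walk X Y) :
    k ≤ finrank K (X.1 ⊓ Y.1 : Submodule K V) + p.length := by
  induction p with
  | @nil X => rw [inf_idem, X.2.2]; simp
  | @cons X Z Y h p ih =>
    have h1 := finrank_inf_of_adj hk h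
    have h2 := Submodule.finrank_sup_add_finrank_inf_eq (X.1 ⊓ Z.1) (Z.1 ⊓ Y.1)
    have h3 := Submodule.finrank_mono
      (sup_le inf_le_right inf_le_left : (X.1 ⊓ Z.1) ⊔ (Z.1 ⊓ Y.1) ≤ Z.1)
    have h4 := Submodule.finrank_mono
      (le_inf (inf_le_left.trans inf_le_left) (inf_le_right.trans inf_le_right) :
        (X.1 ⊓ Z.1) ⊓ (Z.1 ⊓ Y.1) ≤ X.1 ⊓ Y.1)
    rw [Z.2.2] at h3
    rw [SimpleGraph.Walk.length_cons]
    omega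

theorem le_finrank_inf_add_dist (hk : k < W.wittIndex) {X Y : W.SingularSubspace k}
    (h : (W.polarGrassmannGraph k).Reachable X Y) :
    k ≤ finrank K (X.1 ⊓ Y.1 : Submodule K V) + (W.polarGrassmannGraph k).dist X Y := by
  obtain ⟨p, hp⟩ := h.exists_walk_length_eq_dist
  rw [← hp]
  exact le_finrank_inf_add_length hk p

/-- The neighbour of `X` spanned by a hyperplane `H` of `X` and a point `L` over `X ⊓ Y`. -/
theorem exists_neighbour (hk : k < W.wittIndex) {X Y : W.SingularSubspace k} {H L : Submodule K V}
    (hH : H ∈ Submodule.between (X.1 ⊓ Y.1) X.1 (k - 1)) (hk1 : 1 ≤ k)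
    (hL : L ∈ Submodule.between (X.1 ⊓ Y.1) (Y.1 ⊓ W.toPolarData.perp X.1)
      (finrank K (X.1 ⊓ Y.1 : Submodule K V) + 1)) :
    ∃ Z : W.SingularSubspace k, Z.1 = H ⊔ L ∧ (W.polarGrassmannGraph k).Adj X Z ∧
      Z.1 ⊓ X.1 = H ∧ Z.1 ⊓ Y.1 = L := by
  obtain ⟨hH1, hH2, hH3⟩ := hH
  obtain ⟨hL1, hL2, hL3⟩ := hL
  have hLY : L ≤ Y.1 := hL2.trans inf_le_left
  have hXL : X.1 ⊓ L = X.1 ⊓ Y.1 :=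
    le_antisymm (inf_le_inf_left _ hLY) (le_inf inf_le_left hL1)
  have hHL : H ⊓ L = X.1 ⊓ Y.1 :=
    le_antisymm (inf_le_inf hH2 hLY) (le_inf hH1 hL1)
  have hHY : H ⊓ Y.1 = X.1 ⊓ Y.1 :=
    le_antisymm (inf_le_inf_right _ hH2) (le_inf hH1 inf_le_right)
  have h1 := Submodule.finrank_sup_add_finrank_inf_eq X.1 L
  have h2 := Submodule.finrank_sup_add_finrank_inf_eq H L
  rw [hXL, X.2.2] at h1
  rw [hHL] at h2
  have hs : W.toPolarData.IsSing (X.1 ⊔ L) :=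
    X.isSing.sup (Y.isSing.mono hLY) (hL2.trans inf_le_right)
  have hXZ : X.1 ⊔ (H ⊔ L) = X.1 ⊔ L := by
    rw [← sup_assoc, sup_eq_left.2 hH2]
  refine ⟨⟨H ⊔ L, (W.isSingular_iff _).2 (hs.mono (sup_le_sup_right hH2 L)), by omega⟩, rfl,
    (adj_iff hk).2 ?_, ?_, ?_⟩
  · change W.toPolarData.IsSing (X.1 ⊔ (H ⊔ L)) ∧ finrank K (X.1 ⊔ (H ⊔ L) : Submodule K V) = k + 1
    rw [hXZ]
    exact ⟨hs, by omega⟩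
  · change (H ⊔ L) ⊓ X.1 = H
    rw [sup_inf_assoc_of_le L hH2, inf_comm, hXL, sup_eq_left.2 hH1]
  · change (H ⊔ L) ⊓ Y.1 = L
    rw [sup_comm, sup_inf_assoc_of_le H hLY, hHY, sup_eq_left.2 hL1]

/-- Close subspaces are joined by a walk of the least conceivable length, each step of which gains
one dimension of intersection with `Y`. Each step but the last keeps a vector that is orthogonal to
`Y` and outside `Y`, so closeness persists. -/
theorem exists_walk_of_close (hk : k < W.wittIndex) (d : ℕ) : ∀ {X Y : W.SingularSubspace k},
    W.Close X.1 Y.1 → finrank K (X.1 ⊓ Y.1 : Submodule K V) + d = k →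
    ∃ p : (W.polarGrassmannGraph k).Walk X Y, p.length = d := by
  induction d with
  | zero =>
    intro X Y h hd
    have h1 : X.1 ⊓ Y.1 = X.1 := Submodule.eq_of_le_of_finrank_eq inf_le_left (by rw [X.2.2]; omega)
    have h2 : X.1 ⊓ Y.1 = Y.1 :=
      Submodule.eq_of_le_of_finrank_eq inf_le_right (by rw [Y.2.2]; omega)
    obtain rfl : X = Y := Subtype.ext (h1.symm.trans h2)
    exact ⟨.nil, rfl⟩
  | succ d ih =>
    intro X Y h hd
    obtain ⟨x, hx, hxY, hxp⟩ := close_iff_exists.1 h.symm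
    have hle : X.1 ⊓ Y.1 ≤ Y.1 ⊓ W.toPolarData.perp X.1 :=
      le_inf inf_le_right (inf_le_left.trans X.isSing.le_perp)
    obtain ⟨L, hL⟩ := Submodule.exists_finrank_eq_between hle (Nat.le_succ _) h
    rcases Nat.eq_zero_or_pos d with rfl | hd0
    · obtain ⟨Z, hZ, hadj, _, hZY⟩ := exists_neighbour hk (X := X) (Y := Y) (H := X.1 ⊓ Y.1)
        (L := L) ⟨le_rfl, inf_le_left, by omega⟩ (by omega) hL
      have h1 : Z.1 ≤ Y.1 := by
        rw [hZ]
        exact sup_le inf_le_right (hL.2.1.trans inf_le_left)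
      obtain rfl : Z = Y :=
        Subtype.ext (Submodule.eq_of_le_of_finrank_eq h1 (Z.2.2.trans Y.2.2.symm))
      exact ⟨hadj.toWalk, rfl⟩
    · have hx' : x ∉ X.1 ⊓ Y.1 := fun h => hxY h.2
      have h1 := Submodule.finrank_sup_span_singleton hx'
      obtain ⟨H, hH1, hH2, hH3⟩ := Submodule.exists_finrank_eq_between (K := K) (n := k - 1)
        (sup_le inf_le_left (by simpa using hx) : (X.1 ⊓ Y.1) ⊔ K ∙ x ≤ X.1) (by omega)
        (by rw [X.2.2]; omega)
      obtain ⟨Z, hZ, hadj, _, hZY⟩ := exists_neighbour hk (X := X) (Y := Y) (H := H) (L := L)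
        ⟨le_sup_left.trans hH1, hH2, hH3⟩ (by omega) hL
      have hclose : W.Close Z.1 Y.1 := by
        refine Close.symm (close_iff_exists.2 ⟨x, ?_, hxY, hxp⟩)
        rw [hZ]
        exact Submodule.mem_sup_left
          (hH1 (Submodule.mem_sup_right (Submodule.mem_span_singleton_self x)))
      obtain ⟨p, hp⟩ := ih hclose (by rw [hZY, hL.2.2]; omega)
      exact ⟨.cons hadj p, by simp [hp]⟩

theorem dist_of_close (hk : k < W.wittIndex) {X Y : W.SingularSubspace k} (h : W.Close X.1 Y.1) :
    finrank K (X.1 ⊓ Y.1 : Submodule K V) + (W.polarGrassmannGraph k).dist X Y = k := by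
  have h0 := Submodule.finrank_mono (inf_le_left : X.1 ⊓ Y.1 ≤ X.1)
  rw [X.2.2] at h0
  obtain ⟨p, hp⟩ := exists_walk_of_close hk (k - finrank K (X.1 ⊓ Y.1 : Submodule K V)) h
    (by omega)
  have h1 := SimpleGraph.dist_le p
  have h2 := le_finrank_inf_add_dist hk p.reachable
  omega

/-- The neighbours of `X` one step closer to `Y`. -/
def closerNeighbours (W : FormedSpace K V) (X Y : W.SingularSubspace k) :
    Set (W.SingularSubspace k) :=
  {Z | (W.polarGrassmannGraph k).Adj X Z ∧
    (W.polarGrassmannGraph k).dist Z Y + 1 = (W.polarGrassmannGraph k).dist X Y}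

/-- A neighbour `Z` of `X` closer to `Y` is spanned by a hyperplane of `X` containing `X ⊓ Y` and a
subspace of `Y ⊓ X^⊥` of one dimension more than `X ⊓ Y`. -/
theorem closerNeighbours_spec (hk : k < W.wittIndex) {X Y Z : W.SingularSubspace k}
    (h : W.Close X.1 Y.1) (hd : 2 ≤ (W.polarGrassmannGraph k).dist X Y)
    (hZ : Z ∈ W.closerNeighbours X Y) :
    Z.1 ⊓ X.1 ∈ Submodule.between (X.1 ⊓ Y.1) X.1 (k - 1) ∧
    Z.1 ⊓ Y.1 ∈ Submodule.between (X.1 ⊓ Y.1) (Y.1 ⊓ W.toPolarData.perp X.1)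
      (finrank K (X.1 ⊓ Y.1 : Submodule K V) + 1) ∧ (Z.1 ⊓ X.1) ⊔ (Z.1 ⊓ Y.1) = Z.1 := by
  obtain ⟨hadj, hdist⟩ := hZ
  have h0 := dist_of_close hk h
  have h1 := finrank_inf_of_adj hk hadj
  rw [inf_comm] at h1
  have h2 := le_finrank_inf_add_dist hk
    (SimpleGraph.Reachable.of_dist_ne_zero (G := W.polarGrassmannGraph k) (u := Z) (v := Y)
      (by omega))
  have h3 := Submodule.finrank_sup_add_finrank_inf_eq (Z.1 ⊓ X.1) (Z.1 ⊓ Y.1)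
  have hle1 : (Z.1 ⊓ X.1) ⊔ (Z.1 ⊓ Y.1) ≤ Z.1 := sup_le inf_le_left inf_le_left
  have hle2 : (Z.1 ⊓ X.1) ⊓ (Z.1 ⊓ Y.1) ≤ X.1 ⊓ Y.1 :=
    le_inf (inf_le_left.trans inf_le_right) (inf_le_right.trans inf_le_right)
  have h4 := Submodule.finrank_mono hle1
  have h5 := Submodule.finrank_mono hle2
  rw [Z.2.2] at h4
  have heq2 := Submodule.eq_of_le_of_finrank_eq hle2 (by omega)
  have heq1 := Submodule.eq_of_le_of_finrank_eq hle1 (by rw [Z.2.2]; omega)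
  have hXY : X.1 ⊓ Y.1 ≤ Z.1 := by
    rw [← heq2]
    exact inf_le_left.trans inf_le_left
  have hperp : Z.1 ≤ W.toPolarData.perp X.1 :=
    le_sup_right.trans (((adj_iff hk).1 hadj).1.le_perp.trans
      (W.toPolarData.perp_mono le_sup_left))
  exact ⟨⟨le_inf hXY inf_le_left, inf_le_right, by omega⟩,
    ⟨le_inf hXY inf_le_right, le_inf inf_le_right (inf_le_left.trans hperp), by omega⟩, heq1⟩

variable [Finite K]

theorem finite_singularSubspace : Finite (W.SingularSubspace k) := by
  have : Finite V := Module.finite_of_finite K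
  infer_instance

theorem ncard_closerNeighbours_le (hk : k < W.wittIndex) {X Y : W.SingularSubspace k}
    (h : W.Close X.1 Y.1) (hd : 2 ≤ (W.polarGrassmannGraph k).dist X Y) :
    (W.closerNeighbours X Y).ncard ≤ (Submodule.between (X.1 ⊓ Y.1) X.1 (k - 1)).ncard *
      (Submodule.between (X.1 ⊓ Y.1) (Y.1 ⊓ W.toPolarData.perp X.1)
      (finrank K (X.1 ⊓ Y.1 : Submodule K V) + 1)).ncard := by
  rw [← Set.ncard_prod]
  refine Set.ncard_le_ncard_of_injOn (fun Z => (Z.1 ⊓ X.1, Z.1 ⊓ Y.1)) (fun Z hZ => ?_)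
    (fun Z hZ Z' hZ' heq => ?_)
    ((Submodule.finite_of_finite_field _).prod (Submodule.finite_of_finite_field _))
  · obtain ⟨h1, h2, _⟩ := closerNeighbours_spec hk h hd hZ
    exact ⟨h1, h2⟩
  · obtain ⟨_, _, h3⟩ := closerNeighbours_spec hk h hd hZ
    obtain ⟨_, _, h3'⟩ := closerNeighbours_spec hk h hd hZ'
    rw [Prod.mk.injEq] at heq
    apply Subtype.ext
    rw [← h3, ← h3', heq.1, heq.2]

/-- If `Y ⊓ X^⊥` exceeds `X ⊓ Y` by at least two dimensions, all pairs as in `closerNeighbours_spec`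
occur: every hyperplane of `X` over `X ⊓ Y` then still contains a vector orthogonal to `Y` and
outside `Y`, so that the neighbour is close to `Y`. -/
theorem le_ncard_closerNeighbours (hk : k < W.wittIndex) {X Y : W.SingularSubspace k}
    (h : finrank K (X.1 ⊓ Y.1 : Submodule K V) + 2 ≤
      finrank K (Y.1 ⊓ W.toPolarData.perp X.1 : Submodule K V)) (hk1 : 1 ≤ k) :
    (Submodule.between (X.1 ⊓ Y.1) X.1 (k - 1)).ncard *
      (Submodule.between (X.1 ⊓ Y.1) (Y.1 ⊓ W.toPolarData.perp X.1)
      (finrank K (X.1 ⊓ Y.1 : Submodule K V) + 1)).ncard ≤ (W.closerNeighbours X Y).ncard := by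
  have := finite_singularSubspace (W := W) (k := k)
  have hclose : W.Close X.1 Y.1 := by unfold Close; omega
  have h0 := dist_of_close hk hclose
  rw [← Set.ncard_prod]
  have key : ∀ q : Submodule K V × Submodule K V,
      q ∈ Submodule.between (X.1 ⊓ Y.1) X.1 (k - 1) ×ˢ
        Submodule.between (X.1 ⊓ Y.1) (Y.1 ⊓ W.toPolarData.perp X.1)
          (finrank K (X.1 ⊓ Y.1 : Submodule K V) + 1) →
      ∃ Z ∈ W.closerNeighbours X Y, Z.1 ⊓ X.1 = q.1 ∧ Z.1 ⊓ Y.1 = q.2 := by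
    rintro ⟨H, L⟩ ⟨hH, hL⟩
    obtain ⟨Z, hZ, hadj, hZX, hZY⟩ := exists_neighbour hk hH hk1 hL
    refine ⟨Z, ⟨hadj, ?_⟩, hZX, hZY⟩
    have hcl : W.Close Z.1 Y.1 := by
      refine Close.symm ?_
      have h1 := W.toPolarData.finrank_inf_perp_comm (X.2.2.trans Y.2.2.symm)
      have h2 := Submodule.finrank_sup_add_finrank_inf_eq H (X.1 ⊓ W.toPolarData.perp Y.1)
      have h3 := Submodule.finrank_mono
        (sup_le hH.2.1 inf_le_left : H ⊔ (X.1 ⊓ W.toPolarData.perp Y.1) ≤ X.1)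
      rw [X.2.2] at h3
      have h4 : finrank K H = k - 1 := hH.2.2
      rw [close_iff_exists]
      by_contra! hcon
      have h5 : H ⊓ (X.1 ⊓ W.toPolarData.perp Y.1) ≤ X.1 ⊓ Y.1 := by
        rintro z ⟨hz1, hz2, hz3⟩
        refine ⟨hz2, ?_⟩
        by_contra hzY
        exact hcon z (by rw [hZ]; exact Submodule.mem_sup_left hz1) hzY hz3
      have h6 := Submodule.finrank_mono h5
      omega
    have h1 := dist_of_close hk hcl
    have h2 : finrank K L = finrank K (X.1 ⊓ Y.1 : Submodule K V) + 1 := hL.2.2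
    rw [hZY, h2] at h1
    omega
  have : Nonempty (W.SingularSubspace k) := ⟨X⟩
  choose! F hF hF1 hF2 using key
  refine Set.ncard_le_ncard_of_injOn F hF (fun q hq q' hq' heq => ?_) (Set.toFinite _)
  exact Prod.ext (by rw [← hF1 q hq, ← hF1 q' hq', heq]) (by rw [← hF2 q hq, ← hF2 q' hq', heq])

/-- Automorphisms of the graph preserve the rank of the form on close pairs: among close pairs at a
given distance, the number of neighbours of `X` closer to `Y` is strictly increasing in the
dimension of `Y ⊓ X^⊥`. -/
theorem finrank_inf_perp_eq_of_iso (hk : k < W.wittIndex) {X Y X' Y' : W.SingularSubspace k}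
    (φ : W.polarGrassmannGraph k ≃g W.polarGrassmannGraph k) (hX : φ X = X') (hY : φ Y = Y')
    (h : W.Close X.1 Y.1) (h' : W.Close X'.1 Y'.1) :
    finrank K (Y.1 ⊓ W.toPolarData.perp X.1 : Submodule K V) =
      finrank K (Y'.1 ⊓ W.toPolarData.perp X'.1 : Submodule K V) := by
  have key : ∀ {X Y X' Y' : W.SingularSubspace k}
      (φ : W.polarGrassmannGraph k ≃g W.polarGrassmannGraph k), φ X = X' → φ Y = Y' →
      W.Close X.1 Y.1 → W.Close X'.1 Y'.1 →
      finrank K (Y'.1 ⊓ W.toPolarData.perp X'.1 : Submodule K V) ≤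
      finrank K (Y.1 ⊓ W.toPolarData.perp X.1 : Submodule K V) := by
    intro X Y X' Y' φ hX hY h h'
    by_contra! hlt
    have := finite_singularSubspace (W := W) (k := k)
    have hdist := SimpleGraph.dist_map_iso φ X Y
    rw [hX, hY] at hdist
    have h0 := dist_of_close hk h
    have h0' := dist_of_close hk h'
    have hinf : finrank K (X.1 ⊓ Y.1 : Submodule K V) =
        finrank K (X'.1 ⊓ Y'.1 : Submodule K V) := by omega
    have hc : finrank K (X.1 ⊓ Y.1 : Submodule K V) <
      finrank K (Y.1 ⊓ W.toPolarData.perp X.1 : Submodule K V) := h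
    have hY'k := Submodule.finrank_mono (inf_le_left : Y'.1 ⊓ W.toPolarData.perp X'.1 ≤ Y'.1)
    rw [Y'.2.2] at hY'k
    have h1 := ncard_closerNeighbours_le hk h (by omega)
    have h2 := le_ncard_closerNeighbours hk (X := X') (Y := Y') (by omega) (by omega)
    have h3 : (W.closerNeighbours X' Y').ncard ≤ (W.closerNeighbours X Y).ncard := by
      refine Set.ncard_le_ncard_of_injOn φ.symm (fun Z hZ => ⟨?_, ?_⟩) φ.symm.injective.injOn
        (Set.toFinite _)
      · rw [← φ.map_adj_iff, hX]
        simpa using hZ.1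
      · rw [← SimpleGraph.dist_map_iso φ, ← SimpleGraph.dist_map_iso φ X, hX, hY]
        simpa using hZ.2
    have hle : ∀ X Y : W.SingularSubspace k, X.1 ⊓ Y.1 ≤ Y.1 ⊓ W.toPolarData.perp X.1 :=
      fun X Y => le_inf inf_le_right (inf_le_left.trans X.isSing.le_perp)
    have h4 := Submodule.ncard_between_lt (hle X Y) (hle X' Y') hinf hlt
    have h5 := Submodule.ncard_between_eq (inf_le_left : X.1 ⊓ Y.1 ≤ X.1)
      (inf_le_left : X'.1 ⊓ Y'.1 ≤ X'.1) hinf (X.2.2.trans X'.2.2.symm) (k - 1)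
    have h6 := Submodule.ncard_between_pos (inf_le_left : X.1 ⊓ Y.1 ≤ X.1) (n := k - 1)
      (by omega) (by rw [X.2.2]; omega)
    rw [← hinf, ← h5] at h2
    have := Nat.mul_lt_mul_of_pos_left h4 h6
    omega
  exact (key φ.symm (by simp [← hX]) (by simp [← hY]) h' h).antisymm (key φ hX hY h h')

end FormedSpace

/-! ### Geodesics and their codes -/

namespace PolarData

variable {K V : Type*} [Field K] [AddCommGroup V] [Module K V] {S : PolarData K V}

theorem IsIsometry.isSing_map_iff {g : V →ₗ[K] V} (hg : S.IsIsometry g) {U : Submodule K V} :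
    S.IsSing (U.map g) ↔ S.IsSing U := by
  constructor
  · intro h u hu
    refine ⟨?_, fun v hv => ?_⟩
    · rw [← hg.1]
      exact (h _ ⟨u, hu, rfl⟩).1
    · rw [← hg.2]
      exact (h _ ⟨u, hu, rfl⟩).2 _ ⟨v, hv, rfl⟩
  · rintro h _ ⟨u, hu, rfl⟩
    refine ⟨by rw [hg.1, (h u hu).1], ?_⟩
    rintro _ ⟨v, hv, rfl⟩
    rw [hg.2, (h u hu).2 v hv]

theorem IsIsometry.finrank_map {g : V →ₗ[K] V} (hg : S.IsIsometry g) (U : Submodule K V) :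
    finrank K (U.map g) = finrank K U :=
  (Submodule.equivMapOfInjective g hg.injective U).finrank_eq.symm

namespace IsNormal

variable {k m : ℕ} {Y : ℕ → Submodule K V} {e f : ℕ → V} {c : ℕ → ℕ}

theorem isSing_span (h : S.IsNormal k m Y e f c) {p r : ℕ} (hr : r ≤ m) (hrp : r ≤ p + 1) :
    S.IsSing (Submodule.span K (e '' Set.Ico p k ∪ f '' Set.Iio r)) := by
  have hef : ∀ l, p ≤ l → l < k → ∀ j < r, S.B (e l) (f j) = 0 := fun l hl hl' j hj => by
    have := h.le j (by omega)
    rw [h.ef l hl' j (by omega), if_neg (by omega)]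
  refine S.isSing_span ?_ ?_
  · rintro _ (⟨l, hl, rfl⟩ | ⟨j, hj, rfl⟩)
    · exact h.qe l hl.2
    · exact h.qf j (lt_of_lt_of_le hj hr)
  · rintro _ (⟨l, hl, rfl⟩ | ⟨j, hj, rfl⟩) _ (⟨l', hl', rfl⟩ | ⟨j', hj', rfl⟩)
    · exact h.ee _ hl.2 _ hl'.2
    · exact hef _ hl.1 hl.2 _ hj'
    · exact S.B_eq_zero_comm.1 (hef _ hl'.1 hl'.2 _ hj)
    · exact h.ff _ (lt_of_lt_of_le hj hr) _ (lt_of_lt_of_le hj' hr)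

theorem finrank_span_Ico_Iio (h : S.IsNormal k m Y e f c) {p r : ℕ} (hr : r ≤ m) (hp : p ≤ k) :
    finrank K (Submodule.span K (e '' Set.Ico p k ∪ f '' Set.Iio r)) + p = k + r := by
  have := h.finrank_span (s := Finset.Ico p k) (t := Finset.range r)
    (fun l hl => (Finset.mem_Ico.1 hl).2) (fun j hj => lt_of_lt_of_le (Finset.mem_range.1 hj) hr)
  rw [Finset.coe_Ico, Finset.coe_range, Nat.card_Ico, Finset.card_range] at this
  omega

theorem sup_eq (h : S.IsNormal k m Y e f c) {i i' : ℕ} (hi : i ≤ m) (hii : i' ≤ i) :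
    Y i' ⊔ Y i = Submodule.span K (e '' Set.Ico i' k ∪ f '' Set.Iio i) := by
  rw [h.eq_span i hi, h.eq_span i' (hii.trans hi), ← Submodule.span_union]
  congr 1
  apply Set.Subset.antisymm
  · rintro _ ((⟨l, ⟨h1, h2⟩, rfl⟩ | ⟨j, hj, rfl⟩) | (⟨l, ⟨h1, h2⟩, rfl⟩ | ⟨j, hj, rfl⟩))
    · exact Or.inl ⟨l, ⟨h1, h2⟩, rfl⟩
    · exact Or.inr ⟨j, lt_of_lt_of_le hj hii, rfl⟩
    · exact Or.inl ⟨l, ⟨hii.trans h1, h2⟩, rfl⟩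
    · exact Or.inr ⟨j, hj, rfl⟩
  · rintro _ (⟨l, ⟨h1, h2⟩, rfl⟩ | ⟨j, hj, rfl⟩)
    · exact Or.inl (Or.inl ⟨l, ⟨h1, h2⟩, rfl⟩)
    · exact Or.inr (Or.inr ⟨j, hj, rfl⟩)

theorem finrank_eq (h : S.IsNormal k m Y e f c) (hmk : m ≤ k) {i : ℕ} (hi : i ≤ m) :
    finrank K (Y i) = k := by
  have := h.finrank_span_Ico_Iio hi (hi.trans hmk)
  rw [← h.eq_span i hi] at this
  omega

theorem finrank_inf [FiniteDimensional K V] (h : S.IsNormal k m Y e f c) (hmk : m ≤ k) {i i' : ℕ}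
    (hi : i ≤ m) (hii : i' ≤ i) : finrank K (Y i' ⊓ Y i : Submodule K V) + i = k + i' := by
  have h1 := Submodule.finrank_sup_add_finrank_inf_eq (Y i') (Y i)
  rw [h.sup_eq hi hii, h.finrank_eq hmk hi, h.finrank_eq hmk (hii.trans hi)] at h1
  have h2 := h.finrank_span_Ico_Iio hi ((hii.trans hi).trans hmk)
  omega

/-- Vertices of a sequence in normal form are not opposite. -/
theorem finrank_inf_lt [FiniteDimensional K V] (h : S.IsNormal k m Y e f c) (hmk : m ≤ k)
    {i i' : ℕ} (hi : i ≤ m) (hii : i' < i) :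
    finrank K (Y i' ⊓ Y i : Submodule K V) < finrank K (Y i ⊓ S.perp (Y i') : Submodule K V) := by
  have h1 := h.finrank_inf hmk hi hii.le
  have h2 := h.finrank_inf_perp hmk hi hii.le
  have h3 : ((Finset.range i).filter fun j => i' < c j).card ≤ (Finset.Ico (i' + 1) i).card := by
    refine Finset.card_le_card fun j hj => ?_
    obtain ⟨hj, hj'⟩ := Finset.mem_filter.1 hj
    have hj := Finset.mem_range.1 hj
    have := h.le j (by omega)
    exact Finset.mem_Ico.2 ⟨by omega, hj⟩
  rw [Nat.card_Ico] at h3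
  omega

end IsNormal

end PolarData

namespace FormedSpace

variable {K V : Type*} [Field K] [AddCommGroup V] [Module K V] {W : FormedSpace K V} {k m : ℕ}

/-- An isometry induces an automorphism of the polar Grassmann graph. -/
theorem exists_iso_of_isIsometry [Finite K] [FiniteDimensional K V] {g : V →ₗ[K] V}
    (hg : W.toPolarData.IsIsometry g) (hk : k < W.wittIndex) :
    ∃ φ : W.polarGrassmannGraph k ≃g W.polarGrassmannGraph k, ∀ X, (φ X).1 = X.1.map g := by
  have := finite_singularSubspace (W := W) (k := k)
  let F : W.SingularSubspace k → W.SingularSubspace k := fun X =>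
    ⟨X.1.map g, (W.isSingular_iff _).2 (hg.isSing_map_iff.2 X.isSing),
      (hg.finrank_map _).trans X.2.2⟩
  have hF : Function.Injective F := fun X Y h => Subtype.ext
    (Submodule.map_injective_of_injective hg.injective (congrArg Subtype.val h))
  refine ⟨⟨Equiv.ofBijective F (Finite.injective_iff_bijective.1 hF), fun {X Y} => ?_⟩,
    fun X => rfl⟩
  rw [adj_iff hk, adj_iff hk]
  change W.toPolarData.IsSing (X.1.map g ⊔ Y.1.map g) ∧
    finrank K (X.1.map g ⊔ Y.1.map g : Submodule K V) = k + 1 ↔ _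
  rw [← Submodule.map_sup, hg.isSing_map_iff, hg.finrank_map]

/-- The subspaces of a sequence of vertices, indexed by all natural numbers; the sequence is
constant from `m` on. -/
def vertexSeq (X : Fin (m + 1) → W.SingularSubspace k) (i : ℕ) : Submodule K V :=
  (X ⟨min i m, by omega⟩).1

theorem vertexSeq_eq (X : Fin (m + 1) → W.SingularSubspace k) {i : ℕ} (hi : i ≤ m) :
    vertexSeq X i = (X ⟨i, by omega⟩).1 := by
  simp [vertexSeq, hi]

/-- The sequence `X` of vertices has a normal form with code `c`. Only the values `c j` with `j < m`
matter. -/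
def HasCode (X : Fin (m + 1) → W.SingularSubspace k) (c : ℕ → ℕ) : Prop :=
  ∃ e f, W.toPolarData.IsNormal k m (vertexSeq X) e f c

variable [FiniteDimensional K V]

theorem isWalk_vertexSeq (hk : k < W.wittIndex) {X : Fin (m + 1) → W.SingularSubspace k}
    (h : ∀ i : Fin m, (W.polarGrassmannGraph k).Adj (X i.castSucc) (X i.succ)) :
    W.toPolarData.IsWalk k m (vertexSeq X) := by
  refine ⟨fun i hi => ?_, fun i hi => ?_, fun i hi => ?_⟩
  · rw [vertexSeq_eq X hi]; exact (X _).2.2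
  · rw [vertexSeq_eq X hi.le, vertexSeq_eq X hi]
    exact ((adj_iff hk).1 (h ⟨i, hi⟩)).1
  · rw [vertexSeq_eq X hi.le, vertexSeq_eq X hi]
    exact finrank_inf_of_adj hk (h ⟨i, hi⟩)

/-- Non-opposite vertices at distance `m` meet in codimension `m`, so a geodesic between them has a
normal form. -/
theorem exists_hasCode (hk : k < W.wittIndex) (hm : 1 ≤ m)
    {X : Fin (m + 1) → W.SingularSubspace k} (hX : X ∈ W.nonOppositeGeodesics k m) :
    ∃ c, HasCode X c := by
  obtain ⟨⟨hadj, hdist⟩, hopp⟩ := hX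
  have hne : X 0 ≠ X (Fin.last m) := by
    intro h
    rw [h, SimpleGraph.dist_self] at hdist
    omega
  have hd := dist_of_close hk ((not_opposite_iff hne).1 hopp)
  have hw := isWalk_vertexSeq hk hadj
  have hd' : finrank K (vertexSeq X 0 ⊓ vertexSeq X m : Submodule K V) + m ≤ k := by
    rw [hdist] at hd
    rw [vertexSeq_eq X (Nat.zero_le m), vertexSeq_eq X le_rfl]
    exact hd.le
  obtain ⟨U, e, f, c, h⟩ := hw.exists_isPreNormal hd'
  obtain ⟨e', f', h'⟩ := h.exists_isNormal hw hm hd'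
  exact ⟨c, e', f', h'⟩

theorem finrank_le_wittIndex {U : Submodule K V} (hU : W.toPolarData.IsSing U) :
    finrank K U ≤ W.wittIndex :=
  le_csSup ⟨finrank K V, by rintro _ ⟨U, _, rfl⟩; exact U.finrank_le⟩
    ⟨U, (W.isSingular_iff U).2 hU, rfl⟩

theorem exists_finrank_eq_wittIndex (W : FormedSpace K V) :
    ∃ U : Submodule K V, W.toPolarData.IsSing U ∧ finrank K U = W.wittIndex := by
  obtain ⟨U, hU, h⟩ := Nat.sSup_mem (s := {d | ∃ U : Submodule K V, W.IsSingular U ∧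
      finrank K U = d})
    ⟨0, ⊥, (W.isSingular_iff _).2 (fun u hu => by
      rw [(Submodule.mem_bot K).1 hu]
      exact ⟨W.toPolarData.q_zero, by simp⟩), finrank_bot K V⟩
    ⟨finrank K V, by rintro _ ⟨U, _, rfl⟩; exact U.finrank_le⟩
  exact ⟨U, (W.isSingular_iff U).1 hU, h⟩

theorem HasCode.zeros_le {X : Fin (m + 1) → W.SingularSubspace k} {c : ℕ → ℕ} (h : HasCode X c) :
    k + ((Finset.range m).filter fun j => c j = 0).card ≤ W.wittIndex := by
  obtain ⟨e, f, h⟩ := h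
  obtain ⟨U, hU, hU'⟩ := h.exists_isSing
  rw [← hU']
  exact finrank_le_wittIndex hU

theorem HasCode.mem_nonOppositeGeodesics (hk : k < W.wittIndex) (hm : 1 ≤ m) (hmk : m ≤ k)
    {X : Fin (m + 1) → W.SingularSubspace k} {c : ℕ → ℕ} (h : HasCode X c) :
    X ∈ W.nonOppositeGeodesics k m := by
  obtain ⟨e, f, h⟩ := h
  have hclose : W.Close (X 0).1 (X (Fin.last m)).1 := by
    have := h.finrank_inf_lt hmk (le_refl m) (by omega : 0 < m)
    rwa [vertexSeq_eq X (Nat.zero_le m), vertexSeq_eq X le_rfl] at this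
  have hd := dist_of_close hk hclose
  have hinf := h.finrank_inf hmk (le_refl m) (Nat.zero_le m)
  rw [vertexSeq_eq X (Nat.zero_le m), vertexSeq_eq X le_rfl] at hinf
  change finrank K ((X 0).1 ⊓ (X (Fin.last m)).1 : Submodule K V) + m = k + 0 at hinf
  have hdist : (W.polarGrassmannGraph k).dist (X 0) (X (Fin.last m)) = m := by omega
  refine ⟨⟨fun i => (adj_iff hk).2 ?_, hdist⟩, ?_⟩
  · have h1 := h.sup_eq (i := i + 1) (i' := i) i.2 (Nat.le_succ _)
    rw [vertexSeq_eq X i.2.le, vertexSeq_eq X i.2] at h1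
    change (X i.castSucc).1 ⊔ (X i.succ).1 = _ at h1
    rw [h1]
    have h2 := h.finrank_span_Ico_Iio (p := i) (r := i + 1) i.2 (i.2.le.trans hmk)
    exact ⟨h.isSing_span i.2 le_rfl, by omega⟩
  · refine (not_opposite_iff ?_).2 hclose
    intro heq
    rw [heq, SimpleGraph.dist_self] at hdist
    omega

/-- Geodesics with equal codes lie in the same orbit. -/
theorem HasCode.exists_iso [Finite K] (hk : k < W.wittIndex) (hmk : m ≤ k)
    {X X' : Fin (m + 1) → W.SingularSubspace k} {c c' : ℕ → ℕ} (h : HasCode X c)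
    (h' : HasCode X' c') (hc : ∀ j < m, c j = c' j) :
    ∃ φ : W.polarGrassmannGraph k ≃g W.polarGrassmannGraph k, ∀ i, X' i = φ (X i) := by
  obtain ⟨e, f, h⟩ := h
  obtain ⟨e', f', h'⟩ := h'
  obtain ⟨g, hg, hY⟩ := h.exists_isometry hmk h' hc
  obtain ⟨φ, hφ⟩ := exists_iso_of_isIsometry hg hk
  refine ⟨φ, fun i => Subtype.ext ?_⟩
  have hi : i.1 ≤ m := Nat.lt_succ_iff.1 i.2
  have := hY i hi
  rw [vertexSeq_eq X hi, vertexSeq_eq X' hi] at this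
  rw [hφ, ← this]

/-- Geodesics in the same orbit have equal codes. -/
theorem HasCode.eq_of_iso [Finite K] (hk : k < W.wittIndex) (hmk : m ≤ k)
    {X X' : Fin (m + 1) → W.SingularSubspace k} {c c' : ℕ → ℕ} (h : HasCode X c)
    (h' : HasCode X' c') (φ : W.polarGrassmannGraph k ≃g W.polarGrassmannGraph k)
    (hφ : ∀ i, X' i = φ (X i)) : ∀ j < m, c j = c' j := by
  obtain ⟨e, f, h⟩ := h
  obtain ⟨e', f', h'⟩ := h'
  refine h.code_eq hmk h' fun i i' hii hi => ?_
  have h1 := h.finrank_inf_lt hmk hi hii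
  have h2 := h'.finrank_inf_lt hmk hi hii
  have hi' : i' ≤ m := hii.le.trans hi
  rw [vertexSeq_eq X hi, vertexSeq_eq X hi'] at h1 ⊢
  rw [vertexSeq_eq X' hi, vertexSeq_eq X' hi'] at h2 ⊢
  exact finrank_inf_perp_eq_of_iso hk φ (hφ _).symm (hφ _).symm h1 h2

/-- Every code with at most `ω - k` zeros occurs. In a hyperbolic frame on a maximal singular
subspace with basis `a 0, …, a (ω - 1)` and partners `b`, take `e l = a l`, take `f j = b l` if
`c j = l + 1`, and let the unmatched `f j` be `a k, a (k + 1), …`. -/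
theorem exists_hasCode_of_code (hmk : m ≤ k) {c : ℕ → ℕ} (hle : ∀ j < m, c j ≤ j)
    (hinj : ∀ i j, i < j → j < m → c i = c j → c i = 0)
    (hz : k + ((Finset.range m).filter fun j => c j = 0).card ≤ W.wittIndex) :
    ∃ X : Fin (m + 1) → W.SingularSubspace k, HasCode X c := by
  classical
  obtain ⟨U, hU, hUf⟩ := W.exists_finrank_eq_wittIndex
  let B := finBasisOfFinrankEq K U hUf
  set S := W.toPolarData
  set n := W.wittIndex
  have hli : LinearIndependent K fun i => (B i : V) :=
    B.linearIndependent.map' U.subtype U.ker_subtype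
  obtain ⟨b, hab, -⟩ := S.exists_frame (a := fun i => (B i : V)) (b := 0) (s := ∅) hli
    (fun i => (hU _ (B i).2).1) (fun i j => (hU _ (B i).2).2 _ (B j).2) (by simp) (by simp)
    (by simp) (by simp)
  set w : Fin n ⊕ Fin n → V := Sum.elim (fun i => (B i : V)) b with hw
  have hwq : ∀ x, S.q (w x) = 0 := by
    rintro (x | x)
    · exact hab.qa x
    · exact hab.qb x
  -- The position of the `j`-th unmatched vector
  let r : ℕ → ℕ := fun j => k + ((Finset.range j).filter fun j => c j = 0).card
  have hr : ∀ j < m, c j = 0 → r j < n := by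
    intro j hj hcj
    refine lt_of_lt_of_le (Nat.add_lt_add_left (Finset.card_lt_card ?_) k) hz
    refine Finset.ssubset_iff_of_subset ?_ |>.2 ⟨j, by simp [hj, hcj], by simp⟩
    exact Finset.filter_subset_filter _ (Finset.range_subset_range.2 hj.le)
  have hrmono : ∀ i j, i < j → c i = 0 → r i < r j := by
    intro i j hij hci
    refine Nat.add_lt_add_left (Finset.card_lt_card ?_) k
    refine Finset.ssubset_iff_of_subset ?_ |>.2 ⟨i, by simp [hij, hci], by simp⟩
    exact Finset.filter_subset_filter _ (Finset.range_subset_range.2 hij.le)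
  have hkn : k ≤ n := le_trans (Nat.le_add_right _ _) hz
  let P : Fin m → Fin n ⊕ Fin n := fun j =>
    if h : c j = 0 then Sum.inl ⟨r j, hr j j.2 h⟩ else
      Sum.inr ⟨c j - 1, by have := hle j j.2; have := j.2; omega⟩
  let E : Fin k → Fin n ⊕ Fin n := fun l => Sum.inl ⟨l, by have := l.2; omega⟩
  let e : ℕ → V := fun l => if h : l < k then w (E ⟨l, h⟩) else 0
  let f : ℕ → V := fun j => if h : j < m then w (P ⟨j, h⟩) else 0
  have he : ∀ l (h : l < k), e l = w (E ⟨l, h⟩) := fun l h => dif_pos h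
  have hf : ∀ j (h : j < m), f j = w (P ⟨j, h⟩) := fun j h => dif_pos h
  have hP0 : ∀ j (h : c j.1 = 0), P j = Sum.inl ⟨r j, hr j j.2 h⟩ := fun j h => dif_pos h
  have hP1 : ∀ j (h : ¬ c j.1 = 0), P j =
    Sum.inr ⟨c j - 1, by have := hle j j.2; have := j.2; omega⟩ := fun j h => dif_neg h
  have hinj' : Function.Injective (Sum.elim E P) := by
    have hPne : ∀ i j : Fin m, i < j → P i ≠ P j := by
      intro i j hij heq
      by_cases hi : c i = 0 <;> by_cases hj : c j = 0
      · rw [hP0 i hi, hP0 j hj, Sum.inl.injEq, Fin.mk.injEq] at heq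
        exact (hrmono i j hij hi).ne heq
      · rw [hP0 i hi, hP1 j hj] at heq; cases heq
      · rw [hP1 i hi, hP0 j hj] at heq; cases heq
      · rw [hP1 i hi, hP1 j hj, Sum.inr.injEq, Fin.mk.injEq] at heq
        exact hi (hinj i j hij j.2 (by omega))
    refine Function.Injective.sumElim ?_ ?_ ?_
    · intro l l' h
      simp only [E, Sum.inl.injEq, Fin.mk.injEq] at h
      exact Fin.ext h
    · intro i j h
      by_contra hne
      rcases lt_or_gt_of_ne hne with hlt | hlt
      · exact hPne i j hlt h
      · exact hPne j i hlt h.symm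
    · intro l j h
      by_cases hj : c j = 0
      · rw [hP0 j hj] at h
        simp only [E, Sum.inl.injEq, Fin.mk.injEq, r] at h
        have := l.2
        omega
      · rw [hP1 j hj] at h
        cases h
  let Y : ℕ → Submodule K V := fun i => Submodule.span K (e '' Set.Ico i k ∪ f '' Set.Iio i)
  have hN : S.IsNormal k m Y e f c := by
    refine ⟨?_, fun _ _ => rfl, fun l hl => by rw [he l hl, hwq], fun j hj => by rw [hf j hj, hwq],
      fun l hl l' hl' => ?_, fun j hj j' hj' => ?_, fun l hl j hj => ?_, hle, hinj⟩
    · convert hab.linearIndependent.comp _ hinj' using 1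
      ext x
      rcases x with l | j
      · exact he l l.2
      · exact hf j j.2
    · rw [he l hl, he l' hl']
      exact hab.aa _ _
    · rw [hf j hj, hf j' hj']
      by_cases h1 : c j = 0 <;> by_cases h2 : c j' = 0
      · rw [hP0 ⟨j, hj⟩ h1, hP0 ⟨j', hj'⟩ h2]
        exact hab.aa _ _
      · rw [hP0 ⟨j, hj⟩ h1, hP1 ⟨j', hj'⟩ h2]
        refine hab.ab _ _ fun heq => ?_
        have := congrArg Fin.val heq
        have := hle j' hj'
        simp only [r] at *
        omega
      · rw [hP1 ⟨j, hj⟩ h1, hP0 ⟨j', hj'⟩ h2]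
        refine S.B_eq_zero_comm.1 (hab.ab _ _ fun heq => ?_)
        have := congrArg Fin.val heq
        have := hle j hj
        simp only [r] at *
        omega
      · rw [hP1 ⟨j, hj⟩ h1, hP1 ⟨j', hj'⟩ h2]
        exact hab.bb _ _
    · rw [he l hl, hf j hj]
      by_cases h1 : c j = 0
      · rw [hP0 ⟨j, hj⟩ h1, if_neg (by omega)]
        exact hab.aa _ _
      · rw [hP1 ⟨j, hj⟩ h1]
        split_ifs with h2
        · have h3 : (⟨c j - 1, by have := hle j hj; omega⟩ : Fin n) = ⟨l, by omega⟩ :=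
            Fin.ext (by simp; omega)
          change S.B (B ⟨l, _⟩ : V) (b ⟨c j - 1, _⟩) = 1
          rw [h3]
          exact hab.self _
        · refine hab.ab _ _ fun heq => h2 ?_
          have := congrArg Fin.val heq
          simp only at this
          omega
  refine ⟨fun i => ⟨Y i, (W.isSingular_iff _).2 ?_, ?_⟩, e, f, ?_⟩
  · exact hN.isSing_span (Nat.lt_succ_iff.1 i.2) (Nat.le_succ _)
  · exact hN.finrank_eq hmk (Nat.lt_succ_iff.1 i.2)
  · refine { hN with eq_span := fun i hi => ?_ }
    rw [vertexSeq_eq _ hi]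

end FormedSpace

/-! ### Counting codes -/

/-- Set partitions of `n + 1` points classified by the complement of the block of one point. -/
theorem Nat.stirlingSecond_succ_eq_sum (n b : ℕ) : Nat.stirlingSecond (n + 1) (b + 1) =
    ∑ i ∈ Finset.range (n + 1), n.choose i * Nat.stirlingSecond i b := by
  induction n generalizing b with
  | zero => cases b <;> simp [Nat.stirlingSecond]
  | succ n ih =>
    have h1 : ∑ i ∈ Finset.range (n + 2), (n + 1).choose i * Nat.stirlingSecond i b =
        (∑ i ∈ Finset.range (n + 1), n.choose i * Nat.stirlingSecond i b) +
        ∑ i ∈ Finset.range (n + 1), n.choose i * Nat.stirlingSecond (i + 1) b := by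
      rw [Finset.sum_range_succ' (n := n + 1),
        Finset.sum_range_succ' (n := n) (f := fun i => n.choose i * Nat.stirlingSecond i b),
        show ∑ i ∈ Finset.range (n + 1), (n + 1).choose (i + 1) * Nat.stirlingSecond (i + 1) b =
          ∑ i ∈ Finset.range (n + 1), n.choose i * Nat.stirlingSecond (i + 1) b +
          ∑ i ∈ Finset.range (n + 1), n.choose (i + 1) * Nat.stirlingSecond (i + 1) b by
          rw [← Finset.sum_add_distrib]
          exact Finset.sum_congr rfl fun i _ => by rw [Nat.choose_succ_succ, add_mul],
        Finset.sum_range_succ (n := n) (f := fun i => n.choose (i + 1) * _)]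
      simp only [Nat.choose_succ_self, Nat.choose_zero_right]
      ring
    rw [h1, Nat.stirlingSecond_succ_succ, ← ih b]
    cases b with
    | zero =>
      have : ∀ i, Nat.stirlingSecond (i + 1) 0 = 0 := fun i => Nat.stirlingSecond_succ_zero i
      simp [this]
    | succ b =>
      simp only [Nat.stirlingSecond_succ_succ _ b, mul_add, Finset.sum_add_distrib]
      rw [← ih b, show ∑ x ∈ Finset.range (n + 1), n.choose x * ((b + 1) *
        Nat.stirlingSecond x (b + 1)) = (b + 1) * ∑ x ∈ Finset.range (n + 1), n.choose x *
        Nat.stirlingSecond x (b + 1) by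
          rw [Finset.mul_sum]; exact Finset.sum_congr rfl fun _ _ => by ring,
        ← ih (b + 1), Nat.stirlingSecond_succ_succ n b]
      ring

theorem Nat.sum_stirlingSecond_eq_of_le {n N : ℕ} (h : n ≤ N) :
    ∑ b ∈ Finset.range (N + 1), Nat.stirlingSecond n b =
      ∑ b ∈ Finset.range (n + 1), Nat.stirlingSecond n b := by
  refine (Finset.sum_subset (Finset.range_subset_range.2 (by omega)) fun b _ hb => ?_).symm
  exact Nat.stirlingSecond_eq_zero_of_lt (by simpa using hb)

theorem Nat.bell_eq_sum_stirlingSecond (n : ℕ) :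
    Nat.bell n = ∑ b ∈ Finset.range (n + 1), Nat.stirlingSecond n b := by
  induction n using Nat.strong_induction_on with
  | _ n ih =>
    cases n with
    | zero => simp
    | succ n =>
      rw [Nat.bell_succ, ← Nat.range_succ_eq_Iic, Finset.sum_range_succ' (n := n + 1),
        Nat.stirlingSecond_succ_zero, add_zero]
      simp only [Nat.stirlingSecond_succ_eq_sum]
      rw [Finset.sum_comm, ← Finset.sum_range_reflect]
      refine Finset.sum_congr rfl fun i hi => ?_
      have hi := Finset.mem_range.1 hi
      rw [← Finset.mul_sum, Nat.sum_stirlingSecond_eq_of_le (by omega), ih _ (by omega),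
        show n + 1 - 1 - i = n - i by omega, Nat.choose_symm (by omega),
        show n - (n - i) = i by omega]

/-- The codes of length `m`: sequences with `c j ≤ j` (positions counted from zero) whose nonzero
values are distinct. They correspond to the partitions of `{0, …, m - 1}`: the value `c j = l + 1`
says that `l` is the predecessor of `j` in its block, and `c j = 0` that `j` is the least element.
-/
def codes (m : ℕ) : Finset (Fin m → ℕ) :=
  (Fintype.piFinset fun j : Fin m => Finset.range (j + 1)).filter fun c =>
    ∀ i j, i < j → c i = c j → c i = 0

theorem mem_codes {m : ℕ} {c : Fin m → ℕ} :
    c ∈ codes m ↔ (∀ j, c j ≤ j) ∧ ∀ i j, i < j → c i = c j → c i = 0 := by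
  simp [codes]

theorem codes_zero : codes 0 = {Fin.elim0} := by
  ext c
  rw [mem_codes, Finset.mem_singleton]
  exact ⟨fun _ => Subsingleton.elim _ _, fun _ => ⟨fun j => j.elim0, fun j => j.elim0⟩⟩

/-- The number of zeros of a code, that is, of blocks of the corresponding partition. -/
def zeros {m : ℕ} (c : Fin m → ℕ) : ℕ := (Finset.univ.filter fun j => c j = 0).card

/-- A sum over sequences of length `m + 1` as an iterated sum over the initial segments and the
possible last terms. -/
theorem Finset.sum_eq_sum_snoc {m : ℕ} {A' : Finset (Fin (m + 1) → ℕ)} {A : Finset (Fin m → ℕ)}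
    {E : (Fin m → ℕ) → Finset ℕ}
    (h : ∀ t x, (Fin.snoc t x : Fin (m + 1) → ℕ) ∈ A' ↔ t ∈ A ∧ x ∈ E t)
    (F : (Fin (m + 1) → ℕ) → ℚ) :
    ∑ t ∈ A', F t = ∑ t ∈ A, ∑ x ∈ E t, F (Fin.snoc t x : Fin (m + 1) → ℕ) := by
  rw [Finset.sum_sigma']
  refine Finset.sum_nbij' (fun t => ⟨Fin.init t, t (Fin.last m)⟩) (fun p => Fin.snoc p.1 p.2)
    ?_ ?_ ?_ ?_ ?_
  · intro t ht
    rw [Finset.mem_sigma]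
    refine (h _ _).1 ?_
    rwa [Fin.snoc_init_self]
  · rintro ⟨t, x⟩ hp
    exact (h t x).2 (Finset.mem_sigma.1 hp)
  · intro t _
    exact Fin.snoc_init_self t
  · rintro ⟨t, x⟩ _
    simp
  · intro t _
    simp only [Fin.snoc_init_self]

theorem Fin.forall_lt_snoc {m : ℕ} {P : Fin (m + 1) → Fin (m + 1) → Prop} :
    (∀ i j, i < j → P i j) ↔ (∀ i j : Fin m, i < j → P i.castSucc j.castSucc) ∧
      ∀ i : Fin m, P i.castSucc (Fin.last m) := by
  constructor
  · exact fun h =>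
      ⟨fun i j hij => h _ _ (by simpa using hij), fun i => h _ _ (Fin.castSucc_lt_last i)⟩
  · rintro ⟨h1, h2⟩ i j hij
    induction i using Fin.lastCases with
    | last => exact absurd hij (not_lt.2 (Fin.le_last j))
    | cast i =>
      induction j using Fin.lastCases with
      | last => exact h2 i
      | cast j => exact h1 i j (by simpa using hij)

theorem snoc_mem_codes {m : ℕ} (c : Fin m → ℕ) (x : ℕ) :
    (Fin.snoc c x : Fin (m + 1) → ℕ) ∈ codes (m + 1) ↔
      c ∈ codes m ∧ x ∈ (Finset.range (m + 1)).filter fun x => x = 0 ∨ ∀ j, c j ≠ x := by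
  rw [mem_codes, mem_codes, Fin.forall_fin_succ', Fin.forall_lt_snoc, Finset.mem_filter,
    Finset.mem_range]
  simp only [Fin.snoc_castSucc, Fin.snoc_last, Fin.val_castSucc, Fin.val_last]
  constructor
  · rintro ⟨⟨h1, h2⟩, h3, h4⟩
    refine ⟨⟨h1, h3⟩, by omega, ?_⟩
    by_contra! hcon
    obtain ⟨h5, j, hj⟩ := hcon
    exact h5 (hj ▸ h4 j hj)
  · rintro ⟨⟨h1, h3⟩, h2, h4⟩
    refine ⟨⟨h1, by omega⟩, h3, fun i hi => ?_⟩
    rcases h4 with h4 | h4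
    · rw [hi, h4]
    · exact absurd hi (h4 i)

theorem zeros_snoc {m : ℕ} (c : Fin m → ℕ) (x : ℕ) :
    zeros (Fin.snoc c x : Fin (m + 1) → ℕ) = zeros c + if x = 0 then 1 else 0 := by
  simp only [zeros, Finset.card_filter, Fin.sum_univ_castSucc, Fin.snoc_castSucc, Fin.snoc_last]

/-- A code of length `m` can be extended by as many nonzero values as it has zeros, since a
partition has as many largest elements as least elements of blocks. -/
theorem card_free {m : ℕ} {c : Fin m → ℕ} (hc : c ∈ codes m) :
    ((Finset.Ico 1 (m + 1)).filter fun x => ∀ j, c j ≠ x).card = zeros c := by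
  rw [mem_codes] at hc
  have h1 := Finset.card_filter_add_card_filter_not (s := Finset.Ico 1 (m + 1))
    (fun x => ∀ j, c j ≠ x)
  have h2 := Finset.card_filter_add_card_filter_not (s := (Finset.univ : Finset (Fin m)))
    (fun j => c j = 0)
  have h3 : (Finset.Ico 1 (m + 1)).filter (fun x => ¬ ∀ j, c j ≠ x) =
      (Finset.univ.filter fun j => ¬ c j = 0).image c := by
    ext x
    simp only [ne_eq, not_forall, not_not, Finset.mem_filter, Finset.mem_Ico, Finset.mem_image,
      Finset.mem_univ, true_and]
    constructor
    · rintro ⟨h, j, rfl⟩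
      exact ⟨j, by omega, rfl⟩
    · rintro ⟨j, h, rfl⟩
      have := hc.1 j
      have := j.2
      exact ⟨by omega, j, rfl⟩
  have h4 : ((Finset.univ.filter fun j => ¬ c j = 0).image c).card =
      (Finset.univ.filter fun j => ¬ c j = 0).card := by
    refine Finset.card_image_of_injOn fun i hi j _ hij => ?_
    by_contra hne
    have hi : c i ≠ 0 := by simpa using hi
    rcases lt_or_gt_of_ne hne with hlt | hlt
    · exact hi (hc.2 i j hlt hij)
    · exact hi (hij.trans (hc.2 j i hlt hij.symm))
  rw [h3, h4, Nat.card_Ico] at h1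
  rw [Finset.card_univ, Fintype.card_fin] at h2
  unfold zeros
  omega

/-- The recursion for the distribution of `zeros` on codes: a further point joins one of the
`zeros c` blocks or forms a new one. -/
theorem sum_codes_succ (m : ℕ) (φ : ℕ → ℚ) : ∑ c ∈ codes (m + 1), φ (zeros c) =
    ∑ c ∈ codes m, (zeros c * φ (zeros c) + φ (zeros c + 1)) := by
  rw [Finset.sum_eq_sum_snoc snoc_mem_codes]
  refine Finset.sum_congr rfl fun c hc => ?_
  have h1 : (Finset.range (m + 1)).filter (fun x => x = 0 ∨ ∀ j, c j ≠ x) =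
      insert 0 ((Finset.Ico 1 (m + 1)).filter fun x => ∀ j, c j ≠ x) := by
    ext x
    simp only [Finset.mem_filter, Finset.mem_range, Finset.mem_insert, Finset.mem_Ico]
    constructor
    · rintro ⟨h1, rfl | h2⟩
      · exact Or.inl rfl
      · by_cases hx : x = 0
        · exact Or.inl hx
        · exact Or.inr ⟨by omega, h2⟩
    · rintro (rfl | ⟨h1, h2⟩)
      · exact ⟨by omega, Or.inl rfl⟩
      · exact ⟨by omega, Or.inr h2⟩
  rw [h1, Finset.sum_insert (by simp), ← card_free hc,
    Finset.sum_congr rfl (g := fun _ => φ (zeros c))]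
  · rw [zeros_snoc, Finset.sum_const, nsmul_eq_mul, card_free hc]
    simp [add_comm]
  · intro x hx
    have hx := (Finset.mem_Ico.1 (Finset.mem_filter.1 hx).1).1
    rw [zeros_snoc, if_neg (by omega), add_zero]

theorem snoc_mem_admissibleTypes {m s : ℕ} (t : Fin (m + 1) → ℕ) (x : ℕ) :
    (Fin.snoc t x : Fin (m + 2) → ℕ) ∈ admissibleTypes (m + 2) s ↔
      t ∈ admissibleTypes (m + 1) s ∧
        x ∈ ({t (Fin.last m), t (Fin.last m) + 1} : Finset ℕ).filter (· ≤ s) := by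
  rw [mem_admissibleTypes, mem_admissibleTypes, Finset.mem_filter]
  unfold IsAdmissibleType
  constructor
  · rintro ⟨h1, h2, h3⟩
    refine ⟨⟨fun i hi => ?_, fun i j hij => ?_, fun i => ?_⟩, ?_, ?_⟩
    · simpa using h1 i.castSucc (by simpa using hi)
    · simpa using h2 i.castSucc j.castSucc (by simpa using hij)
    · simpa using h3 i.castSucc
    · simpa using h2 (Fin.last m).castSucc (Fin.last (m + 1)) (by simp)
    · simpa using h3 (Fin.last (m + 1))
  · rintro ⟨⟨h1, h2, h3⟩, h4, h5⟩
    refine ⟨fun i hi => ?_, fun i j hij => ?_, fun i => ?_⟩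
    · induction i using Fin.lastCases with
      | last => simp at hi
      | cast i => simpa using h1 i (by simpa using hi)
    · induction i using Fin.lastCases with
      | last => have := j.2; simp at hij; omega
      | cast i =>
        induction j using Fin.lastCases with
        | last =>
          have : i = Fin.last m := Fin.ext (by simp at hij; simp; omega)
          subst this
          simpa using h4
        | cast j => simpa using h2 i j (by simpa using hij)
    · induction i using Fin.lastCases with
      | last => simpa using h5
      | cast i => simpa using h3 i

/-- The recursion of `sum_codes_succ` for the distribution of the last term of an admissible type,
weighted by `typeCount`: a repeated last term `z` multiplies the weight by `z`, and a new last term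
`z + 1` multiplies it by `(z + 1) / (z + 1) = 1`. The test function vanishes beyond the bound `s`,
which takes care of the type `z = s`, whose last term cannot grow. -/
theorem sum_admissibleTypes_succ (m s : ℕ) (φ : ℕ → ℚ) (hφ : ∀ b, s < b → φ b = 0) :
    ∑ t ∈ admissibleTypes (m + 2) s, typeCount (by omega) t * φ (t (Fin.last _)) =
    ∑ t ∈ admissibleTypes (m + 1) s, typeCount (by omega) t *
      (t (Fin.last _) * φ (t (Fin.last _)) + φ (t (Fin.last _) + 1)) := by
  rw [Finset.sum_eq_sum_snoc snoc_mem_admissibleTypes]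
  refine Finset.sum_congr rfl fun t ht => ?_
  have hc : ∀ x, typeCount (by omega : 1 ≤ m + 2) (Fin.snoc t x : Fin (m + 2) → ℕ) =
      (∏ i, (t i : ℚ)) * x / (x.factorial : ℚ) := by
    intro x
    have : (Fin.snoc t x : Fin (m + 2) → ℕ) ⟨m + 2 - 1, by omega⟩ = x :=
      Fin.snoc_last (α := fun _ => ℕ) x t
    simp only [typeCount, this, Fin.prod_univ_castSucc (n := m + 1), Fin.snoc_castSucc,
      Fin.snoc_last]
  have hc' : typeCount (by omega : 1 ≤ m + 1) t =
    (∏ i, (t i : ℚ)) / ((t (Fin.last m)).factorial : ℚ) := rfl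
  set z := t (Fin.last m) with hz
  rw [Finset.sum_filter_of_ne, Finset.sum_pair (by omega), hc, hc, hc']
  · simp only [Fin.snoc_last, Nat.factorial_succ, Nat.cast_mul]
    have : ((z + 1 : ℕ) : ℚ) ≠ 0 := by positivity
    have : (z.factorial : ℚ) ≠ 0 := by positivity
    field_simp
  · intro x _ hx
    by_contra hcon
    exact hx (by rw [Fin.snoc_last, hφ x (by omega), mul_zero])

theorem sum_codes_eq_sum_admissibleTypes (m s : ℕ) (φ : ℕ → ℚ) (hs : 1 ≤ s)
    (hφ : ∀ b, s < b → φ b = 0) :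
    ∑ c ∈ codes (m + 1), φ (zeros c) =
      ∑ t ∈ admissibleTypes (m + 1) s, typeCount (by omega) t * φ (t (Fin.last m)) := by
  induction m generalizing φ with
  | zero =>
    have h1 : admissibleTypes 1 s = {fun _ => 1} := by
      ext t
      rw [mem_admissibleTypes, Finset.mem_singleton, IsAdmissibleType]
      constructor
      · rintro ⟨h1, -, -⟩
        ext i
        exact h1 i (by omega)
      · rintro rfl
        exact ⟨fun _ _ => rfl, fun _ _ _ => Or.inl rfl, fun _ => hs⟩
    rw [sum_codes_succ, h1, codes_zero]
    simp [zeros, typeCount]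
  | succ m ih =>
    rw [sum_codes_succ, sum_admissibleTypes_succ m s φ hφ,
      ih (fun b => b * φ b + φ (b + 1)) fun b hb => by rw [hφ b hb, hφ (b + 1) (by omega)]; simp]

theorem sum_codes_eq_sum_stirlingSecond (m : ℕ) (φ : ℕ → ℚ) :
    ∑ c ∈ codes m, φ (zeros c) =
      ∑ b ∈ Finset.range (m + 1), (Nat.stirlingSecond m b : ℚ) * φ b := by
  induction m generalizing φ with
  | zero =>
    rw [codes_zero]
    simp [zeros]
  | succ m ih =>
    have h : ∑ b ∈ Finset.range (m + 1), (Nat.stirlingSecond m b : ℚ) * (b * φ b) =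
        ∑ b ∈ Finset.range (m + 1), (Nat.stirlingSecond m (b + 1) : ℚ) * ((b + 1) * φ (b + 1)) := by
      rw [Finset.sum_range_succ', Finset.sum_range_succ (n := m),
        Nat.stirlingSecond_eq_zero_of_lt (Nat.lt_succ_self m)]
      simp
    rw [sum_codes_succ, ih fun b => b * φ b + φ (b + 1), Finset.sum_range_succ' (n := m + 1),
      Nat.stirlingSecond_succ_zero]
    simp only [mul_add, Finset.sum_add_distrib]
    rw [h, ← Finset.sum_add_distrib, Nat.cast_zero, zero_mul, add_zero]
    refine Finset.sum_congr rfl fun b _ => ?_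
    rw [Nat.stirlingSecond_succ_succ]
    push_cast
    ring

theorem card_codes (m : ℕ) : (codes m).card = Nat.bell m := by
  have := sum_codes_eq_sum_stirlingSecond m fun _ => 1
  rw [Nat.bell_eq_sum_stirlingSecond]
  simp only [Finset.sum_const, nsmul_eq_mul, mul_one] at this
  exact_mod_cast this

theorem card_codes_filter {m : ℕ} (hm : 1 ≤ m) {s : ℕ} (hs : 1 ≤ s) :
    (((codes m).filter fun c => zeros c ≤ s).card : ℚ) =
      ∑ t ∈ admissibleTypes m s, typeCount hm t := by
  obtain ⟨m, rfl⟩ := Nat.exists_eq_add_of_le' hm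
  have := sum_codes_eq_sum_admissibleTypes m s (fun b => if b ≤ s then 1 else 0) hs
    fun b hb => if_neg (by omega)
  rw [Finset.card_filter, Nat.cast_sum]
  simp only [Nat.cast_ite, Nat.cast_one, Nat.cast_zero]
  rw [this]
  refine Finset.sum_congr rfl fun t ht => ?_
  rw [if_pos ((mem_admissibleTypes.1 ht).2.2 _), mul_one]

theorem zeros_le {m : ℕ} (c : Fin m → ℕ) : zeros c ≤ m :=
  (Finset.card_filter_le _ _).trans (by simp)

/-! ### Counting orbits -/

namespace FormedSpace

variable {K V : Type*} [Field K] [AddCommGroup V] [Module K V] {W : FormedSpace K V} {k m : ℕ}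

/-- The extension by zero of a code to the natural numbers. -/
def extendCode (c : Fin m → ℕ) (j : ℕ) : ℕ := if h : j < m then c ⟨j, h⟩ else 0

theorem extendCode_apply (c : Fin m → ℕ) (j : Fin m) : extendCode c j = c j := dif_pos j.2

theorem zeros_eq (c : ℕ → ℕ) :
    zeros (fun j : Fin m => c j) = ((Finset.range m).filter fun j => c j = 0).card := by
  rw [zeros, Finset.card_filter, Finset.card_filter, Finset.sum_range]

/-- The orbits of geodesics with non-opposite ends correspond to the codes with at most `ω - k`
zeros. -/
theorem ncard_nonOppositeGeodesicOrbits [Finite K] [FiniteDimensional K V] (hk : k < W.wittIndex)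
    (hm : 1 ≤ m) (hmk : m ≤ k) : (W.nonOppositeGeodesicOrbits k m).ncard =
      ((codes m).filter fun c => zeros c ≤ W.wittIndex - k).card := by
  classical
  have hex : ∀ c : Fin m → ℕ, c ∈ (codes m).filter (fun c => zeros c ≤ W.wittIndex - k) →
      ∃ X : Fin (m + 1) → W.SingularSubspace k, HasCode X (extendCode c) := by
    intro c hc
    obtain ⟨hc, hz⟩ := Finset.mem_filter.1 hc
    rw [mem_codes] at hc
    refine exists_hasCode_of_code hmk (fun j hj => ?_) (fun i j hij hj h => ?_) ?_
    · rw [extendCode_apply c ⟨j, hj⟩]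
      exact hc.1 ⟨j, hj⟩
    · rw [extendCode_apply c ⟨j, hj⟩, extendCode_apply c ⟨i, hij.trans hj⟩] at h
      rw [extendCode_apply c ⟨i, hij.trans hj⟩]
      exact hc.2 _ _ hij h
    · rw [← zeros_eq, show (fun j : Fin m => extendCode c j) = c from
        funext (extendCode_apply c)]
      omega
  have hne : Nonempty (Fin (m + 1) → W.SingularSubspace k) := by
    obtain ⟨U, hU, hUf⟩ := W.exists_finrank_eq_wittIndex
    obtain ⟨H, -, hH, hHk⟩ := Submodule.exists_finrank_eq_between (bot_le : ⊥ ≤ U) (n := k)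
      (by rw [finrank_bot]; omega) (by omega)
    exact ⟨fun _ => ⟨H, (W.isSingular_iff H).2 (hU.mono hH), hHk⟩⟩
  choose! X hX using hex
  rw [← Set.ncard_coe_finset]
  symm
  refine Set.ncard_congr (fun c _ => (W.polarGrassmannGraph k).autOrbit (X c)) ?_ ?_ ?_
  · intro c hc
    exact ⟨X c, (hX c hc).mem_nonOppositeGeodesics hk hm hmk, rfl⟩
  · intro c c' hc hc' heq
    have hself : X c' ∈ (W.polarGrassmannGraph k).autOrbit (X c') :=
      ⟨SimpleGraph.Iso.refl, fun _ => rfl⟩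
    rw [← heq] at hself
    obtain ⟨φ, hφ⟩ := hself
    have h := (hX c hc).eq_of_iso hk hmk (hX c' hc') φ hφ
    ext j
    have := h j j.2
    rwa [extendCode_apply, extendCode_apply] at this
  · rintro _ ⟨Z, hZ, rfl⟩
    obtain ⟨c, hc⟩ := exists_hasCode hk hm hZ
    have hz := hc.zeros_le
    obtain ⟨e, f, hn⟩ := id hc
    have hmem : (fun j : Fin m => c j) ∈ (codes m).filter fun c => zeros c ≤ W.wittIndex - k := by
      refine Finset.mem_filter.2 ⟨mem_codes.2 ⟨fun j => hn.le j j.2,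
        fun i j hij h => hn.inj i j hij j.2 h⟩, ?_⟩
      rw [zeros_eq]
      omega
    refine ⟨_, hmem, ?_⟩
    obtain ⟨φ, hφ⟩ := (hX _ hmem).exists_iso hk hmk hc fun j hj =>
      extendCode_apply (fun j : Fin m => c j) ⟨j, hj⟩
    ext T
    constructor
    · rintro ⟨ψ, hψ⟩
      exact ⟨φ.symm.trans ψ, fun i => by rw [hψ, hφ]; simp⟩
    · rintro ⟨ψ, hψ⟩
      exact ⟨φ.trans ψ, fun i => by rw [hψ, hφ]; simp⟩

end FormedSpace

/-- The hypotheses `1 ≤ m ≤ k < ω` contain `1 ≤ k` and `2 ≤ ω`. -/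
theorem proposition4p4 {K V : Type*} [Field K] [Finite K] [AddCommGroup V] [Module K V]
    [FiniteDimensional K V] (W : FormedSpace K V) (k m : ℕ) (hk : k < W.wittIndex)
    (hm : 1 ≤ m) (hmk : m ≤ k) :
    ((W.nonOppositeGeodesicOrbits k m).ncard : ℚ) =
        ∑ t ∈ admissibleTypes m (W.wittIndex - k), typeCount hm t ∧
      (m ≤ W.wittIndex - k → (W.nonOppositeGeodesicOrbits k m).ncard = Nat.bell m) := by
  rw [FormedSpace.ncard_nonOppositeGeodesicOrbits hk hm hmk]
  refine ⟨card_codes_filter hm (by omega), fun h => ?_⟩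
  rw [Finset.filter_true_of_mem fun c _ => (zeros_le c).trans h, card_codes]
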